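/- **Setting.** Let $f:\mathbb R^n\to[-1,1]$ be a labelling function, $z\in\mathbb R^n$ a point of interest, and let $\|\cdot\|$ be the Euclidean norm. Let $\alpha:\mathbb R_+\to\mathbb R_+$ be a non-increasing weight function with $\alpha(\|x-z\|)\le \frac{1}{2\|x-z\|(\|x-z\|+1)}$ for every $x\ne z$. For a finite dataset $X$ of points of $\mathbb R^n$ (repetitions allowed) put $$\mathcal L(\phi,X)=\frac1{|X|}\sum_{x\in X}\alpha(\|x-z\|)\,\bigl(\phi^\top(x-z)-f(x)\bigr)^2,\qquad \mathcal C=\{\phi\in\mathbb R^n:\|\phi\|\le1\}.$$ Fix a public size parameter $m\ge1$, an integer $T\ge1$, privacy parameters $\epsilon,\delta>0$, a learning rate $\eta(t)$ and an initial point $\phi^{\{1\}}\in\mathcal C$. With $$\sigma=\frac1{m\epsilon}\sqrt{16\,T\,\log\Bigl(\mathrm e+\frac{\sqrt T\,\epsilon}{\delta}\Bigr)\log\frac T\delta}$$ the algorithm computes, for $t=1,\dots,T-1$, $$\phi^{\{t+1\}}=\operatorname*{argmin}_{\phi\in\mathcal C}\bigl\|\phi-\bigl(\phi^{\{t\}}-\eta(t)[\nabla\mathcal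 L(\phi^{\{t\}},X)+w_t]\bigr)\bigr\|,\qquad w_t\sim\mathcal N(0,\sigma^2 I)\text{ independent},$$ and outputs $\phi^{\mathrm{Priv}}(X)=\phi^{\{T\}}$. Let $\mathcal E=\mathbb E[\mathcal L(\phi^{\mathrm{Priv}}(X),X)]-\min_{\phi\in\mathcal C}\mathcal L(\phi,X)$ be its expected excess loss. Assume $\epsilon\le\max\{1,2\log(1/\delta)\}$. **Theorem.** 1. (Privacy) For every $T\ge1$ and every learning rate $\eta$, the algorithm is $(\epsilon,\delta)$-differentially private with respect to the explanation dataset: for all datasets $X,X'$ that differ by the omission of one point, one of which has size $m$, and every measurable $S\subseteq\mathbb R^n$, $$\Pr[\phi^{\mathrm{Priv}}(X)\in S]\le \mathrm e^{\epsilon}\Pr[\phi^{\mathrm{Priv}}(X')\in S]+\delta,$$ where $m$, and hence $\sigma$, is the same for $X$ and $X'$. 2. (Utility) There is an absolute constant $C>0$ such that the following holds for every dataset $X$ of size $m$, every $c>0$ and the learning rate $\eta(t)=c/\sqrt t$. If $2\le T\le\min\Bigl(\frac{m^2\epsilon^2}{32n\log^2(\mathrm e+1/\delta)},\frac1\delta\Bigr)$,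 then $$\mathcal E\le C\Bigl(c+\frac1c\Bigr)\frac{\log T}{\sqrt T}.$$ If $T=\Bigl\lfloor\frac{m^2\epsilon^2}{32n\log^2(\mathrm e+1/\delta)}\Bigr\rfloor$ and $2\le T\le 1/\delta$, then $$\mathcal E\le C\Bigl(c+\frac1c\Bigr)\log\Bigl(\mathrm e+\frac1\delta\Bigr)\frac{\sqrt n\,\log m}{m\,\epsilon}.$$ -/

import Mathlib

open MeasureTheory ProbabilityTheory
open scoped Gradient NNReal ENNReal

noncomputable section

namespace DPExplain

/-- The feature space, with the Euclidean norm. -/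
abbrev Vec (n : ℕ) : Type := EuclideanSpace ℝ (Fin n)

/-- The empirical local loss
`L(φ, z, X, f) = (1 / |X|) ∑_{x ∈ X} α(‖x - z‖) (φᵀ (x - z) - f x)²`.
A dataset is a finite multiset of points, so repeated records are allowed. -/
def localLoss {n : ℕ} (α : ℝ≥0 → ℝ≥0) (f : Vec n → ℝ) (z : Vec n)
    (X : Multiset (Vec n)) (φ : Vec n) : ℝ :=
  (1 / (Multiset.card X : ℝ)) *
    (X.map fun x => (α ‖x - z‖₊ : ℝ) * (inner ℝ φ (x - z) - f x) ^ 2).sum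

/-- The family `F(c, z)` of weight functions: `α` is non-increasing and
`α(‖x - z‖) ≤ c / (2 ‖x - z‖ (‖x - z‖ + 1))` for every `x`
(for `x = z` the right-hand side is `+∞`, so there is no condition). -/
def weightFamily {n : ℕ} (c : ℝ) (z : Vec n) : Set (ℝ≥0 → ℝ≥0) :=
  {α | Antitone α ∧
    ∀ x : Vec n, x ≠ z → (α ‖x - z‖₊ : ℝ) ≤ c / (2 * ‖x - z‖ * (‖x - z‖ + 1))}

/-- The set of admissible explanations: the Euclidean unit ball. -/
def feasible (n : ℕ) : Set (Vec n) := {φ | ‖φ‖ ≤ 1}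

/-- Euclidean projection onto the unit ball; `proj_mem` and `proj_spec` show that it is the unique
minimizer of `‖φ - ξ‖` over `φ` in the unit ball. -/
def proj {n : ℕ} (ξ : Vec n) : Vec n := (max 1 ‖ξ‖)⁻¹ • ξ

theorem proj_mem {n : ℕ} (ξ : Vec n) : proj ξ ∈ feasible n := by
  have h : 0 < max 1 ‖ξ‖ := lt_of_lt_of_le one_pos (le_max_left _ _)
  simp only [feasible, proj, Set.mem_ofPred_eq, norm_smul, norm_inv, Real.norm_eq_abs,
    abs_of_pos h]
  rw [inv_mul_le_iff₀ h, mul_one]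
  exact le_max_right _ _

theorem proj_spec {n : ℕ} (ξ φ : Vec n) (hφ : φ ∈ feasible n) :
    ‖proj ξ - ξ‖ ^ 2 + ‖φ - proj ξ‖ ^ 2 ≤ ‖φ - ξ‖ ^ 2 := by
  have hφ' : ‖φ‖ ≤ 1 := hφ
  have key : 0 ≤ inner ℝ (φ - proj ξ) (proj ξ - ξ) := by
    rcases le_total ‖ξ‖ 1 with h | h
    · simp [proj, max_eq_left h]
    · have h0 : 0 < ‖ξ‖ := lt_of_lt_of_le one_pos h
      have e : proj ξ - ξ = (‖ξ‖⁻¹ - 1) • ξ := by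
        simp [proj, max_eq_right h, sub_smul]
      have hip : inner ℝ φ ξ ≤ ‖ξ‖ := by
        have := real_inner_le_norm φ ξ
        nlinarith
      have e2 : inner ℝ (proj ξ) ξ = ‖ξ‖ := by
        simp only [proj, max_eq_right h, inner_smul_left, real_inner_self_eq_norm_sq]
        simp
        field_simp
      rw [e, inner_smul_right, inner_sub_left, e2]
      have : ‖ξ‖⁻¹ ≤ 1 := inv_le_one_of_one_le₀ h
      nlinarith
  have : φ - ξ = (φ - proj ξ) + (proj ξ - ξ) := by abel
  rw [this, norm_add_sq_real]
  linarith

/-- The noise level `σ = (1 / (m ε)) √(16 T log(e + √T ε / δ) log(T / δ))`. -/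
def noiseLevel (m T : ℕ) (ε δ : ℝ) : ℝ :=
  1 / (m * ε) *
    √(16 * T * Real.log (Real.exp 1 + √(T : ℝ) * ε / δ) * Real.log (T / δ))

/-- The law of an i.i.d. sequence of `N(0, σ² I)` vectors. -/
def noiseLaw (n : ℕ) (σ : ℝ) : Measure (ℕ → Vec n) :=
  Measure.infinitePi fun _ => multivariateGaussian (0 : Vec n) (σ ^ 2 • (1 : Matrix _ _ ℝ))

/-- Noisy projected gradient descent for the objective `L`, with learning rate `η`, initial point
`φ₀` and noise sequence `w`. Here `iterate L η φ₀ w k` is the iterate `φ^{k+1}`, that is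
`φ^{1} = φ₀` and `φ^{t+1} = proj (φ^{t} - η(t) [∇L(φ^{t}) + w_t])` for `t = 1, 2, …`. -/
def iterate {n : ℕ} (L : Vec n → ℝ) (η : ℕ → ℝ) (φ₀ : Vec n) (w : ℕ → Vec n) : ℕ → Vec n
  | 0 => φ₀
  | k + 1 =>
    proj (iterate L η φ₀ w k - η (k + 1) • (∇ L (iterate L η φ₀ w k) + w (k + 1)))

/-- The law of the output `φ^{T}` of the private explanation algorithm on the dataset `X`.
The number `m` is the public size parameter of the algorithm, which fixes the noise level. -/
def explanationLaw {n : ℕ} (α : ℝ≥0 → ℝ≥0) (f : Vec n → ℝ) (z : Vec n) (m T : ℕ) (ε δ : ℝ)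
    (η : ℕ → ℝ) (φ₀ : Vec n) (X : Multiset (Vec n)) : Measure (Vec n) :=
  (noiseLaw n (noiseLevel m T ε δ)).map fun w => iterate (localLoss α f z X) η φ₀ w (T - 1)

/-- Neighbouring datasets: one arises from the other by omitting a single record. -/
def Neighbouring {n : ℕ} (X X' : Multiset (Vec n)) : Prop :=
  ∃ x, X = x ::ₘ X' ∨ X' = x ::ₘ X

/-- `(ε, δ)`-differential privacy, at dataset size `m`, of a randomized mechanism given by its
output laws: the inequality is required for all neighbouring datasets, one of which has size `m`.
Both directions are included, because the condition on `X` and `X'` is symmetric. -/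
def IsDifferentiallyPrivate {n : ℕ} (m : ℕ) (ε δ : ℝ)
    (M : Multiset (Vec n) → Measure (Vec n)) : Prop :=
  ∀ X X' : Multiset (Vec n), Neighbouring X X' →
    (Multiset.card X = m ∨ Multiset.card X' = m) →
    ∀ S : Set (Vec n), MeasurableSet S →
      M X S ≤ ENNReal.ofReal (Real.exp ε) * M X' S + ENNReal.ofReal δ

/-- `φs` is an optimal explanation: it minimizes the loss `L` over the unit ball. -/
def IsOptimal {n : ℕ} (L : Vec n → ℝ) (φs : Vec n) : Prop :=
  φs ∈ feasible n ∧ ∀ φ ∈ feasible n, L φs ≤ L φ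

/-- The expected excess loss of a random explanation with law `P` is finite-valued (the loss is
integrable) and at most `B`: `E[L(φ)] - L(φs) ≤ B` for every optimal `φs`. -/
def ExcessLossLE {n : ℕ} (L : Vec n → ℝ) (P : Measure (Vec n)) (B : ℝ) : Prop :=
  Integrable L P ∧ ∀ φs, IsOptimal L φs → (∫ φ, L φ ∂P) - L φs ≤ B

/-- The number `m² ε² / (32 n log²(e + 1/δ))`. -/
def iterationBudget (n m : ℕ) (ε δ : ℝ) : ℝ :=
  (m : ℝ) ^ 2 * ε ^ 2 / (32 * n * Real.log (Real.exp 1 + 1 / δ) ^ 2)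

theorem contDiff_localLoss {n : ℕ} (α : ℝ≥0 → ℝ≥0) (f : Vec n → ℝ) (z : Vec n)
    (X : Multiset (Vec n)) : ContDiff ℝ 1 (localLoss α f z X) := by
  have : ContDiff ℝ 1 fun φ : Vec n =>
      (X.map fun x => (α ‖x - z‖₊ : ℝ) * (inner ℝ φ (x - z) - f x) ^ 2).sum := by
    induction X using Multiset.induction_on with
    | empty => simpa using contDiff_const
    | cons a s ih =>
      simp only [Multiset.map_cons, Multiset.sum_cons]
      exact (contDiff_const.mul
        (((contDiff_id.inner ℝ contDiff_const).sub contDiff_const).pow 2)).add ih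
  exact contDiff_const.mul this

theorem measurable_iterate {n : ℕ} (L : Vec n → ℝ) (hL : ContDiff ℝ 1 L) (η : ℕ → ℝ)
    (φ₀ : Vec n) (k : ℕ) : Measurable fun w => iterate L η φ₀ w k := by
  have hg : Continuous (∇ L) :=
    (InnerProductSpace.toDual ℝ (Vec n)).symm.continuous.comp (hL.continuous_fderiv one_ne_zero)
  have hp : Measurable (proj : Vec n → Vec n) := by unfold proj; fun_prop
  induction k with
  | zero => exact measurable_const
  | succ k ih =>
    have h1 : Measurable fun w : ℕ → Vec n => ∇ L (iterate L η φ₀ w k) + w (k + 1) :=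
      (hg.measurable.comp ih).add (measurable_pi_apply _)
    exact hp.comp (ih.sub (h1.const_smul (η (k + 1))))

/-- The output law is a probability measure. -/
theorem isProbabilityMeasure_explanationLaw {n : ℕ} (α : ℝ≥0 → ℝ≥0) (f : Vec n → ℝ) (z : Vec n)
    (m T : ℕ) (ε δ : ℝ) (η : ℕ → ℝ) (φ₀ : Vec n) (X : Multiset (Vec n)) :
    IsProbabilityMeasure (explanationLaw α f z m T ε δ η φ₀ X) := by
  have : IsProbabilityMeasure (noiseLaw n (noiseLevel m T ε δ)) := by
    unfold noiseLaw; infer_instance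
  exact Measure.isProbabilityMeasure_map
    (measurable_iterate _ (contDiff_localLoss α f z X) η φ₀ _).aemeasurable

/-- Optimal explanations exist. -/
theorem exists_isOptimal {n : ℕ} (α : ℝ≥0 → ℝ≥0) (f : Vec n → ℝ) (z : Vec n)
    (X : Multiset (Vec n)) : ∃ φs, IsOptimal (localLoss α f z X) φs := by
  have e : feasible n = Metric.closedBall 0 1 := by ext; simp [feasible]
  obtain ⟨φs, h1, h2⟩ := (isCompact_closedBall (0 : Vec n) 1).exists_isMinOn
    ⟨0, by simp⟩ (contDiff_localLoss α f z X).continuous.continuousOn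
  exact ⟨φs, e ▸ h1, fun φ hφ => h2 (e ▸ hφ)⟩

end DPExplain

end

/-!
Privacy. One step of the algorithm releases the gradient of the loss at the current iterate with
Gaussian noise. The weights decay so fast that a record contributes a vector of norm at most `1` to
the gradient (`norm_gradSum_term_le_one`), so omitting a record moves the gradient by at most
`2 / m` (`norm_gradient_sub_le_of_neighbouring`). The privacy loss is controlled by Rényi divergence,
in the dual form `RenyiDom`: `∫ h dP ≤ K (∫ h^q dQ)^(1/q)` for all `h ≥ 0`. In this form
post-processing and adaptive composition (`RenyiDom.map_prod`) are immediate from Fubini's theorem,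
which gives both the bound for a Gaussian vector, from that on the line, and the bound for the whole
run of the algorithm (`renyiDom_iterate`). Taking for `h` the indicator of an event turns the bound
into `(ε, δ)`-privacy (`RenyiDom.le_exp_mul_add`), for a suitable order of the divergence.

Utility. The loss is convex with gradients of norm at most `1` on the unit ball, and the upper bound
on `T` keeps the expected squared norm `n σ²` of the noise at most `3`
(`natCast_mul_sq_noiseLevel_le`). So this is stochastic gradient descent with bounded second moments,
and the argument of Shamir and Zhang for the last iterate applies: the usual one-step inequality
holds relative to any comparison point independent of the noise of the step (`integral_step_le`), in
particular relative to earlier iterates. Hence the average loss over the last `k + 1` steps exceeds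
that over the last `k + 2` steps by only `O((c + 1/c) / ((k + 1) √T))`, and summing over `k` gives a
harmonic sum, whence the factor `log T` (`last_iterate_le`). For the largest `T` that the budget
allows, `log T ≤ 2 log m`, and `1 / √T` is `8 √n log(e + 1/δ) / (m ε)` at most.
-/

namespace DPExplain

/-! ### Rényi bounds and the Gaussian mechanism -/

/-- Dual form of a bound on the Rényi divergence of `P` from `Q`, with `q` the exponent conjugate to
the order `p`: by duality of `L^p(Q)` and `L^q(Q)`, for `P ≪ Q` it says that the density `dP/dQ` has
`L^p(Q)`-norm at most `K`. No density occurs, so that the bound visibly passes to image measures and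
to successive random steps. -/
def RenyiDom {Ω : Type*} [MeasurableSpace Ω] (q : ℝ) (K : ℝ≥0∞) (P Q : Measure Ω) : Prop :=
  ∀ h : Ω → ℝ≥0∞, Measurable h → ∫⁻ x, h x ∂P ≤ K * (∫⁻ x, h x ^ q ∂Q) ^ (1 / q)

namespace RenyiDom

variable {Ω Ω' B : Type*} [MeasurableSpace Ω] [MeasurableSpace Ω'] [MeasurableSpace B]
  {q : ℝ} {K K' : ℝ≥0∞} {P Q : Measure Ω}

theorem mono (h : RenyiDom q K P Q) (hK : K ≤ K') : RenyiDom q K' P Q := fun g hg =>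
  (h g hg).trans (mul_le_mul_left hK _)

theorem map (h : RenyiDom q K P Q) {f : Ω → Ω'} (hf : Measurable f) :
    RenyiDom q K (P.map f) (Q.map f) := by
  intro g hg
  rw [lintegral_map hg hf, lintegral_map (hg.pow_const q) hf]
  exact h _ (hg.comp hf)

protected theorem refl {p q : ℝ} (hpq : p.HolderConjugate q) (P : Measure Ω)
    [IsProbabilityMeasure P] : RenyiDom q 1 P P := by
  intro h hh
  simpa using ENNReal.lintegral_mul_le_Lp_mul_Lq P hpq
    (f := fun _ => 1) aemeasurable_const hh.aemeasurable

/-- Adaptive composition: if a second random step, whose randomness has law `γ`, satisfies a Rényi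
bound for almost every outcome `a` of the first, then the bounds multiply. -/
theorem map_prod {γ : Measure B} [SFinite γ] [SFinite P] [SFinite Q] (hq : 0 < q)
    (hPQ : RenyiDom q K P Q) {F G : Ω × B → Ω'} (hF : Measurable F) (hG : Measurable G)
    (hstep : ∀ᵐ a ∂P, RenyiDom q K' (γ.map fun b => F (a, b)) (γ.map fun b => G (a, b))) :
    RenyiDom q (K' * K) ((P.prod γ).map F) ((Q.prod γ).map G) := by
  intro h hh
  have hGq : Measurable fun x => h (G x) ^ q := (hh.comp hG).pow_const q
  have hH : Measurable fun a => (∫⁻ b, h (G (a, b)) ^ q ∂γ) ^ (1 / q) :=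
    hGq.lintegral_prod_right'.pow_const _
  rw [lintegral_map hh hF, lintegral_map (hh.pow_const q) hG,
    lintegral_prod (fun x => h (F x)) (hh.comp hF).aemeasurable, lintegral_prod _ hGq.aemeasurable]
  calc ∫⁻ a, ∫⁻ b, h (F (a, b)) ∂γ ∂P
      ≤ ∫⁻ a, K' * (∫⁻ b, h (G (a, b)) ^ q ∂γ) ^ (1 / q) ∂P := by
        refine lintegral_mono_ae (hstep.mono fun a ha => ?_)
        have hFa : Measurable fun b => F (a, b) := hF.comp measurable_prodMk_left
        have hGa : Measurable fun b => G (a, b) := hG.comp measurable_prodMk_left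
        have := ha h hh
        rwa [lintegral_map hh hFa, lintegral_map (hh.pow_const q) hGa] at this
    _ = K' * ∫⁻ a, (∫⁻ b, h (G (a, b)) ^ q ∂γ) ^ (1 / q) ∂P := lintegral_const_mul _ hH
    _ ≤ K' * (K * (∫⁻ a, ((∫⁻ b, h (G (a, b)) ^ q ∂γ) ^ (1 / q)) ^ q ∂Q) ^ (1 / q)) := by
        gcongr
        exact hPQ _ hH
    _ = K' * K * (∫⁻ a, ∫⁻ b, h (G (a, b)) ^ q ∂γ ∂Q) ^ (1 / q) := by
        rw [mul_assoc]
        congr 4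
        ext a
        rw [← ENNReal.rpow_mul, one_div_mul_cancel hq.ne', ENNReal.rpow_one]

end RenyiDom

/-- Hölder's inequality applied to the density of `N(a, 1)` with respect to `N(b, 1)`, whose
`L^p`-norm is a value of the moment generating function of `N(b, 1)`. -/
theorem renyiDom_gaussianReal {p q : ℝ} (hpq : p.HolderConjugate q) (a b : ℝ) :
    RenyiDom q (ENNReal.ofReal (Real.exp ((p - 1) / 2 * (a - b) ^ 2)))
      (gaussianReal a 1) (gaussianReal b 1) := by
  intro h hh
  have hp : 0 < p := hpq.pos
  set ρ : ℝ → ℝ := fun x => Real.exp ((a - b) * x - (a ^ 2 - b ^ 2) / 2) with hρ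
  have hρm : Measurable fun x => ENNReal.ofReal (ρ x) := by fun_prop
  have hpdf : ∀ x, gaussianPDF a 1 x = gaussianPDF b 1 x * ENNReal.ofReal (ρ x) := by
    intro x
    rw [gaussianPDF, gaussianPDF, ← ENNReal.ofReal_mul (gaussianPDFReal_nonneg _ _ _), hρ]
    simp only [gaussianPDFReal, mul_assoc, ← Real.exp_add]
    congr 4
    push_cast
    ring
  have e1 : ∫⁻ x, h x ∂(gaussianReal a 1)
      = ∫⁻ x, ((fun x => ENNReal.ofReal (ρ x)) * h) x ∂(gaussianReal b 1) := by
    rw [gaussianReal_of_var_ne_zero _ one_ne_zero, gaussianReal_of_var_ne_zero _ one_ne_zero,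
      lintegral_withDensity_eq_lintegral_mul _ (measurable_gaussianPDF _ _) hh,
      lintegral_withDensity_eq_lintegral_mul _ (measurable_gaussianPDF _ _) (hρm.mul hh)]
    simp only [Pi.mul_apply, hpdf, mul_assoc]
  have e2 : (∫⁻ x, ENNReal.ofReal (ρ x) ^ p ∂(gaussianReal b 1)) ^ (1 / p)
      = ENNReal.ofReal (Real.exp ((p - 1) / 2 * (a - b) ^ 2)) := by
    have e3 : ∀ x, ENNReal.ofReal (ρ x) ^ p = ENNReal.ofReal
        (Real.exp (-(p * (a ^ 2 - b ^ 2) / 2)) * Real.exp (p * (a - b) * x)) := by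
      intro x
      rw [ENNReal.ofReal_rpow_of_pos (Real.exp_pos _), ← Real.exp_mul, ← Real.exp_add]
      congr 2
      ring
    have e4 : ∫ x, Real.exp (p * (a - b) * x) ∂(gaussianReal b 1)
        = Real.exp (b * (p * (a - b)) + (p * (a - b)) ^ 2 / 2) := by
      have := congrFun (mgf_fun_id_gaussianReal (μ := b) (v := 1)) (p * (a - b))
      simpa [mgf] using this
    simp_rw [e3]
    rw [← ofReal_integral_eq_lintegral_ofReal
      ((integrable_exp_mul_gaussianReal _).const_mul _)
      (Filter.Eventually.of_forall fun x => by positivity), integral_const_mul, e4,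
      ← Real.exp_add, ENNReal.ofReal_rpow_of_pos (Real.exp_pos _), ← Real.exp_mul]
    congr 2
    field_simp
    ring
  rw [e1, ← e2]
  exact ENNReal.lintegral_mul_le_Lp_mul_Lq _ hpq hρm.aemeasurable hh.aemeasurable

theorem measurable_finCons {n : ℕ} :
    Measurable fun z : ℝ × (Fin n → ℝ) => (Fin.cons z.1 z.2 : Fin (n + 1) → ℝ) := by
  refine measurable_pi_iff.2 fun i => ?_
  induction i using Fin.cases with
  | zero => simpa using measurable_fst
  | succ i => simp only [Fin.cons_succ]; fun_prop

theorem measurable_finCons_add {n : ℕ} (u : Fin (n + 1) → ℝ) :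
    Measurable fun z : ℝ × (Fin n → ℝ) =>
      (Fin.cons z.1 (Fin.tail u + z.2) : Fin (n + 1) → ℝ) :=
  measurable_finCons.comp (by fun_prop : Measurable fun z : ℝ × (Fin n → ℝ) =>
    (z.1, Fin.tail u + z.2))

theorem map_const_add_pi_gaussianReal_succ {n : ℕ} (u : Fin (n + 1) → ℝ) :
    (Measure.pi fun _ => gaussianReal 0 1).map (fun x => u + x)
      = ((gaussianReal (u 0) 1).prod (Measure.pi fun _ : Fin n => gaussianReal 0 1)).map
        fun z => (Fin.cons z.1 (Fin.tail u + z.2) : Fin (n + 1) → ℝ) := by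
  have h1 := (measurePreserving_piFinSuccAbove (fun _ : Fin (n + 1) => gaussianReal 0 1) 0).symm
  have h2 : gaussianReal (u 0) 1 = (gaussianReal 0 1).map (u 0 + ·) := by
    rw [gaussianReal_map_const_add]; simp
  have h3 : (Measure.pi fun _ : Fin n => gaussianReal 0 1)
      = (Measure.pi fun _ : Fin n => gaussianReal 0 1).map id := Measure.map_id.symm
  rw [← h1.map_eq, h2, h3, Measure.map_prod_map _ _ (by fun_prop) measurable_id, ← h3,
    Measure.map_map (by fun_prop) h1.measurable,
    Measure.map_map (measurable_finCons_add u) (by fun_prop)]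
  congr 1
  ext z i
  induction i using Fin.cases with
  | zero => simp [MeasurableEquiv.piFinSuccAbove]
  | succ i => simp [MeasurableEquiv.piFinSuccAbove, Fin.tail]

/-- Tensorization over the coordinates: the exponents of the one-dimensional bounds add up. -/
theorem renyiDom_pi_gaussianReal {p q : ℝ} (hpq : p.HolderConjugate q) {n : ℕ} (u v : Fin n → ℝ) :
    RenyiDom q (ENNReal.ofReal (Real.exp ((p - 1) / 2 * ∑ i, (u i - v i) ^ 2)))
      ((Measure.pi fun _ => gaussianReal 0 1).map fun x => u + x)
      ((Measure.pi fun _ => gaussianReal 0 1).map fun x => v + x) := by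
  induction n with
  | zero =>
    obtain rfl : u = v := Subsingleton.elim _ _
    simpa using (RenyiDom.refl hpq (Measure.pi fun _ : Fin 0 => gaussianReal 0 1)).map
      (measurable_const_add u)
  | succ n ih =>
    rw [map_const_add_pi_gaussianReal_succ, map_const_add_pi_gaussianReal_succ]
    refine ((renyiDom_gaussianReal hpq (u 0) (v 0)).map_prod
      (γ := Measure.pi fun _ : Fin n => gaussianReal 0 1)
      (K' := ENNReal.ofReal (Real.exp ((p - 1) / 2 * ∑ i, (Fin.tail u i - Fin.tail v i) ^ 2)))
      hpq.symm.pos (measurable_finCons_add u)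
      (measurable_finCons_add v) (Filter.Eventually.of_forall fun a => ?_)).mono ?_
    · have hc : Measurable fun x : Fin n → ℝ => (Fin.cons a x : Fin (n + 1) → ℝ) :=
        measurable_finCons.comp measurable_prodMk_left
      have := (ih (Fin.tail u) (Fin.tail v)).map hc
      rwa [Measure.map_map hc (by fun_prop), Measure.map_map hc (by fun_prop)] at this
    · rw [← ENNReal.ofReal_mul (by positivity), ← Real.exp_add, Fin.sum_univ_succ]
      refine le_of_eq ?_
      congr 2
      simp only [Fin.tail]
      ring

/-- The law `N(0, σ² I)` of a single noise vector is that of `σ` times a vector of independent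
standard normal coordinates. -/
theorem multivariateGaussian_sq_smul_one {n : ℕ} {σ : ℝ} (hσ : 0 ≤ σ) :
    multivariateGaussian (0 : Vec n) (σ ^ 2 • (1 : Matrix _ _ ℝ))
      = (Measure.pi fun _ => gaussianReal 0 1).map fun x => σ • WithLp.toLp 2 x := by
  open scoped MatrixOrder in
  have h : CFC.sqrt (σ ^ 2 • (1 : Matrix (Fin n) (Fin n) ℝ)) = σ • 1 := by
    refine CFC.sqrt_unique ?_ ?_
    · simp [smul_smul, pow_two]
    · exact smul_nonneg hσ zero_le_one
  rw [multivariateGaussian, ← map_pi_eq_stdGaussian, Measure.map_map (by fun_prop) (by fun_prop), h]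
  congr 1
  ext x i
  simp

/-- Gaussian mechanism: with noise `N(0, σ² I)`, moving the centre by at most `Δ` costs a factor
`exp((p - 1) Δ² / (2 σ²))` in the Rényi bound of order `p`. -/
theorem renyiDom_multivariateGaussian {p q : ℝ} (hpq : p.HolderConjugate q) {n : ℕ} {σ Δ : ℝ}
    (hσ : 0 < σ) {u v : Vec n} (huv : ‖u - v‖ ≤ Δ) :
    RenyiDom q (ENNReal.ofReal (Real.exp ((p - 1) / 2 * (Δ ^ 2 / σ ^ 2))))
      ((multivariateGaussian (0 : Vec n) (σ ^ 2 • (1 : Matrix _ _ ℝ))).map (u + ·))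
      ((multivariateGaussian (0 : Vec n) (σ ^ 2 • (1 : Matrix _ _ ℝ))).map (v + ·)) := by
  have hf : Measurable fun x : Fin n → ℝ => σ • (WithLp.toLp 2 x : Vec n) := by fun_prop
  have key : ∀ u : Vec n,
      (multivariateGaussian (0 : Vec n) (σ ^ 2 • (1 : Matrix _ _ ℝ))).map (u + ·)
      = ((Measure.pi fun _ => gaussianReal 0 1).map fun x => σ⁻¹ • u.ofLp + x).map
        fun x => σ • (WithLp.toLp 2 x : Vec n) := by
    intro u
    rw [multivariateGaussian_sq_smul_one hσ.le, Measure.map_map (by fun_prop) hf,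
      Measure.map_map hf (by fun_prop)]
    congr 1
    ext x i
    simp [hσ.ne']
  rw [key, key]
  refine ((renyiDom_pi_gaussianReal hpq _ _).map hf).mono ?_
  refine ENNReal.ofReal_le_ofReal (Real.exp_le_exp.2 ?_)
  have hp : 0 ≤ (p - 1) / 2 := by linarith [hpq.lt]
  have h1 : ∑ i, ((σ⁻¹ • u.ofLp) i - (σ⁻¹ • v.ofLp) i) ^ 2 = ‖u - v‖ ^ 2 / σ ^ 2 := by
    rw [EuclideanSpace.real_norm_sq_eq, Finset.sum_div]
    refine Finset.sum_congr rfl fun i _ => ?_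
    simp
    field_simp
  rw [h1]
  gcongr

theorem RenyiDom.apply_le {Ω : Type*} [MeasurableSpace Ω] {q : ℝ} {K : ℝ≥0∞} {P Q : Measure Ω}
    (h : RenyiDom q K P Q) (hq : 0 < q) {S : Set Ω} (hS : MeasurableSet S) :
    P S ≤ K * Q S ^ (1 / q) := by
  have h1 := h (S.indicator 1) (measurable_one.indicator hS)
  have h2 : ∀ x, (S.indicator (1 : Ω → ℝ≥0∞) x) ^ q = S.indicator 1 x := by
    intro x
    by_cases hx : x ∈ S <;> simp [hx, hq]
  simp_rw [h2] at h1
  rwa [lintegral_indicator_one hS, lintegral_indicator_one hS] at h1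

/-- Conversion of a Rényi bound of order `p = lam + 1` into `(ε, δ)`-privacy. The hypothesis on `V`
says that the constant `K` of the Rényi bound satisfies `K ≤ (e^ε)^{1/q} δ^{1/p}`, so `K Q(S)^{1/q}`
is at most a weighted geometric mean of `e^ε Q(S)` and `δ`. -/
theorem RenyiDom.le_exp_mul_add {Ω : Type*} [MeasurableSpace Ω] {P Q : Measure Ω}
    [IsProbabilityMeasure P] [IsProbabilityMeasure Q] {lam V ε δ : ℝ} (hlam : 0 < lam) (hδ : 0 < δ)
    (h : RenyiDom ((lam + 1) / lam) (ENNReal.ofReal (Real.exp (lam / 2 * V))) P Q)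
    (hV : lam * (lam + 1) * V / 2 - ε * lam + Real.log (1 / δ) ≤ 0) {S : Set Ω}
    (hS : MeasurableSet S) : P S ≤ ENNReal.ofReal (Real.exp ε) * Q S + ENNReal.ofReal δ := by
  have h1 := h.apply_le (by positivity) hS
  set s := (Q S).toReal with hs
  have hs0 : 0 ≤ s := ENNReal.toReal_nonneg
  have hQ : Q S = ENNReal.ofReal s := (ENNReal.ofReal_toReal (measure_ne_top _ _)).symm
  rw [hQ] at h1 ⊢
  rw [ENNReal.ofReal_rpow_of_nonneg hs0 (by positivity), ← ENNReal.ofReal_mul (by positivity)] at h1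
  rw [← ENNReal.ofReal_mul (by positivity), ← ENNReal.ofReal_add (by positivity) hδ.le]
  refine h1.trans (ENNReal.ofReal_le_ofReal ?_)
  have hw : (0 : ℝ) ≤ 1 / ((lam + 1) / lam) := by positivity
  have hw' : (0 : ℝ) ≤ 1 / (lam + 1) := by positivity
  have hsum : 1 / ((lam + 1) / lam) + 1 / (lam + 1) = 1 := by field_simp
  have am := Real.geom_mean_le_arith_mean2_weighted hw hw'
    (mul_nonneg (Real.exp_pos ε).le hs0) hδ.le hsum
  rw [Real.mul_rpow (Real.exp_pos ε).le hs0] at am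
  have hK : Real.exp (lam / 2 * V) ≤ Real.exp ε ^ (1 / ((lam + 1) / lam)) * δ ^ (1 / (lam + 1)) := by
    rw [← Real.exp_mul, Real.rpow_def_of_pos hδ, ← Real.exp_add, Real.exp_le_exp]
    rw [one_div δ, Real.log_inv] at hV
    have : ε * (1 / ((lam + 1) / lam)) + Real.log δ * (1 / (lam + 1))
        = (ε * lam + Real.log δ) / (lam + 1) := by field_simp
    rw [this, le_div_iff₀ (by linarith)]
    linarith
  have e1 : 1 / ((lam + 1) / lam) ≤ 1 := by linarith
  have e2 : 1 / (lam + 1) ≤ 1 := by linarith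
  calc _ ≤ _ := mul_le_mul_of_nonneg_right hK (Real.rpow_nonneg hs0 _)
    _ = _ := by ring
    _ ≤ _ := am
    _ ≤ _ := add_le_add (mul_le_of_le_one_left (by positivity) e1)
      (mul_le_of_le_one_left hδ.le e2)

/-! ### The gradient of the loss -/

/-- The sum over `x ∈ X` of the gradients of the summands of the loss, in closed form. -/
noncomputable def gradSum {n : ℕ} (α : ℝ≥0 → ℝ≥0) (f : Vec n → ℝ) (z : Vec n) (X : Multiset (Vec n))
    (φ : Vec n) : Vec n :=
  (X.map fun x => (2 * (α ‖x - z‖₊ : ℝ) * (inner ℝ φ (x - z) - f x)) • (x - z)).sum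

theorem gradient_localLoss {n : ℕ} (α : ℝ≥0 → ℝ≥0) (f : Vec n → ℝ) (z : Vec n)
    (X : Multiset (Vec n)) (φ : Vec n) :
    ∇ (localLoss α f z X) φ = (1 / (Multiset.card X : ℝ)) • gradSum α f z X φ := by
  apply HasGradientAt.gradient
  have key : HasFDerivAt (fun φ : Vec n =>
      (X.map fun x => (α ‖x - z‖₊ : ℝ) * (inner ℝ φ (x - z) - f x) ^ 2).sum)
      (innerSL ℝ (gradSum α f z X φ)) φ := by
    unfold gradSum
    induction X using Multiset.induction_on with
    | empty => simpa using hasFDerivAt_const (0 : ℝ) φ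
    | cons a s ih =>
      simp only [Multiset.map_cons, Multiset.sum_cons, map_add]
      refine HasFDerivAt.add ?_ ih
      have h1 : HasFDerivAt (fun φ : Vec n => inner ℝ φ (a - z)) (innerSL ℝ (a - z)) φ :=
        (innerSL ℝ (a - z)).hasFDerivAt.congr_of_eventuallyEq
          (Filter.Eventually.of_forall fun y => real_inner_comm _ _)
      refine (((h1.sub_const (f a)).pow 2).const_mul (α ‖a - z‖₊ : ℝ)).congr_fderiv ?_
      ext y
      simp
      ring
  rw [hasGradientAt_iff_hasFDerivAt]
  refine (key.const_mul (1 / (Multiset.card X : ℝ))).congr_fderiv ?_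
  ext y
  simp

/-- This is where the decay of the weights is used: it makes a single record contribute at most `1`,
however far it is from `z`. -/
theorem norm_gradSum_term_le_one {n : ℕ} {α : ℝ≥0 → ℝ≥0} {f : Vec n → ℝ} {z : Vec n}
    (hf : ∀ x, |f x| ≤ 1) (hα : α ∈ weightFamily 1 z) {φ : Vec n} (hφ : φ ∈ feasible n)
    (x : Vec n) :
    ‖(2 * (α ‖x - z‖₊ : ℝ) * (inner ℝ φ (x - z) - f x)) • (x - z)‖ ≤ 1 := by
  rcases eq_or_ne x z with rfl | hx
  · simp
  have hr : 0 < ‖x - z‖ := norm_pos_iff.2 (sub_ne_zero.2 hx)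
  have hφ' : ‖φ‖ ≤ 1 := hφ
  have h1 : |inner ℝ φ (x - z) - f x| ≤ ‖x - z‖ + 1 := by
    refine (abs_sub _ _).trans (add_le_add ?_ (hf x))
    exact (abs_real_inner_le_norm _ _).trans (mul_le_of_le_one_left hr.le hφ')
  have h2 := hα.2 x hx
  rw [norm_smul, Real.norm_eq_abs, abs_mul, abs_of_nonneg (by positivity)]
  calc 2 * (α ‖x - z‖₊ : ℝ) * |inner ℝ φ (x - z) - f x| * ‖x - z‖
      ≤ 2 * (1 / (2 * ‖x - z‖ * (‖x - z‖ + 1))) * (‖x - z‖ + 1) * ‖x - z‖ := by gcongr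
    _ = 1 := by field_simp

theorem norm_gradSum_le_card {n : ℕ} {α : ℝ≥0 → ℝ≥0} {f : Vec n → ℝ} {z : Vec n}
    (hf : ∀ x, |f x| ≤ 1) (hα : α ∈ weightFamily 1 z) {φ : Vec n} (hφ : φ ∈ feasible n)
    (X : Multiset (Vec n)) : ‖gradSum α f z X φ‖ ≤ Multiset.card X := by
  unfold gradSum
  induction X using Multiset.induction_on with
  | empty => simp
  | cons a s ih =>
    simp only [Multiset.map_cons, Multiset.sum_cons, Multiset.card_cons, Nat.cast_add,
      Nat.cast_one]
    linarith [norm_add_le ((2 * (α ‖a - z‖₊ : ℝ) * (inner ℝ φ (a - z) - f a)) • (a - z))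
      (s.map fun x => (2 * (α ‖x - z‖₊ : ℝ) * (inner ℝ φ (x - z) - f x)) • (x - z)).sum,
      norm_gradSum_term_le_one hf hα hφ a]

theorem norm_gradient_localLoss_le_one {n : ℕ} {α : ℝ≥0 → ℝ≥0} {f : Vec n → ℝ} {z : Vec n}
    (hf : ∀ x, |f x| ≤ 1) (hα : α ∈ weightFamily 1 z) {φ : Vec n} (hφ : φ ∈ feasible n)
    (X : Multiset (Vec n)) : ‖∇ (localLoss α f z X) φ‖ ≤ 1 := by
  rw [gradient_localLoss, norm_smul, Real.norm_of_nonneg (by positivity), one_div_mul_eq_div]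
  exact div_le_one_of_le₀ (norm_gradSum_le_card hf hα hφ X) (by positivity)

theorem norm_gradient_cons_sub_le {n : ℕ} {α : ℝ≥0 → ℝ≥0} {f : Vec n → ℝ} {z : Vec n}
    (hf : ∀ x, |f x| ≤ 1) (hα : α ∈ weightFamily 1 z) {φ : Vec n} (hφ : φ ∈ feasible n)
    (x : Vec n) (X : Multiset (Vec n)) :
    ‖∇ (localLoss α f z (x ::ₘ X)) φ - ∇ (localLoss α f z X) φ‖
      ≤ 2 / (Multiset.card X + 1 : ℝ) := by
  -- The new gradient is the average of the old one, with weight `|X|`, and of that of `x`.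
  have hN : (0 : ℝ) < Multiset.card X + 1 := by positivity
  have e : ∇ (localLoss α f z (x ::ₘ X)) φ - ∇ (localLoss α f z X) φ
      = (1 / (Multiset.card X + 1 : ℝ)) •
        ((2 * (α ‖x - z‖₊ : ℝ) * (inner ℝ φ (x - z) - f x)) • (x - z)
          - ∇ (localLoss α f z X) φ) := by
    rw [gradient_localLoss, gradient_localLoss]
    rcases X.empty_or_exists_mem with rfl | ⟨y, hy⟩
    · simp [gradSum]
    have hX : (Multiset.card X : ℝ) ≠ 0 := by
      exact_mod_cast (Multiset.card_pos_iff_exists_mem.2 ⟨y, hy⟩).ne'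
    have : gradSum α f z (x ::ₘ X) φ
        = (2 * (α ‖x - z‖₊ : ℝ) * (inner ℝ φ (x - z) - f x)) • (x - z) + gradSum α f z X φ := by
      simp [gradSum]
    rw [this, Multiset.card_cons]
    push_cast
    match_scalars <;> field_simp
    ring
  rw [e, norm_smul, Real.norm_of_nonneg (by positivity), one_div_mul_eq_div]
  gcongr
  linarith [norm_sub_le ((2 * (α ‖x - z‖₊ : ℝ) * (inner ℝ φ (x - z) - f x)) • (x - z))
    (∇ (localLoss α f z X) φ), norm_gradSum_term_le_one hf hα hφ x,
    norm_gradient_localLoss_le_one hf hα hφ X]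

/-- Sensitivity of the gradient; the empty dataset, whose loss is `0`, is included. -/
theorem norm_gradient_sub_le_of_neighbouring {n m : ℕ} {α : ℝ≥0 → ℝ≥0} {f : Vec n → ℝ} {z : Vec n}
    (hf : ∀ x, |f x| ≤ 1) (hα : α ∈ weightFamily 1 z) {φ : Vec n} (hφ : φ ∈ feasible n)
    (hm : 0 < m) {X X' : Multiset (Vec n)} (h : Neighbouring X X')
    (hc : Multiset.card X = m ∨ Multiset.card X' = m) :
    ‖∇ (localLoss α f z X) φ - ∇ (localLoss α f z X') φ‖ ≤ 2 / (m : ℝ) := by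
  have hm' : (0 : ℝ) < m := by exact_mod_cast hm
  obtain ⟨x, rfl | rfl⟩ := h
  · refine (norm_gradient_cons_sub_le hf hα hφ x X').trans ?_
    gcongr
    rw [Multiset.card_cons] at hc
    exact_mod_cast (by omega : m ≤ Multiset.card X' + 1)
  · rw [norm_sub_rev]
    refine (norm_gradient_cons_sub_le hf hα hφ x X).trans ?_
    gcongr
    rw [Multiset.card_cons] at hc
    exact_mod_cast (by omega : m ≤ Multiset.card X + 1)

theorem convex_localLoss_gradient_ineq {n : ℕ} (α : ℝ≥0 → ℝ≥0) (f : Vec n → ℝ) (z : Vec n)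
    (X : Multiset (Vec n)) (φ ψ : Vec n) :
    localLoss α f z X φ - localLoss α f z X ψ ≤ inner ℝ (∇ (localLoss α f z X) φ) (φ - ψ) := by
  have key : (X.map fun x => (α ‖x - z‖₊ : ℝ) * (inner ℝ φ (x - z) - f x) ^ 2).sum
      - (X.map fun x => (α ‖x - z‖₊ : ℝ) * (inner ℝ ψ (x - z) - f x) ^ 2).sum
      ≤ inner ℝ (gradSum α f z X φ) (φ - ψ) := by
    unfold gradSum
    induction X using Multiset.induction_on with
    | empty => simp
    | cons a s ih =>
      simp only [Multiset.map_cons, Multiset.sum_cons, inner_add_left, inner_smul_left]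
      have e : inner ℝ (a - z) (φ - ψ) = inner ℝ φ (a - z) - inner ℝ ψ (a - z) := by
        rw [inner_sub_right, real_inner_comm, real_inner_comm ψ]
      rw [e]
      have := mul_nonneg (α ‖a - z‖₊).coe_nonneg
        (sq_nonneg (inner ℝ φ (a - z) - inner ℝ ψ (a - z)))
      simp only [conj_trivial]
      nlinarith
  rw [gradient_localLoss, inner_smul_left, localLoss, localLoss, ← mul_sub]
  exact mul_le_mul_of_nonneg_left key (by positivity)

/-! ### The law of the iterates -/

theorem iterate_mem_feasible {n : ℕ} (L : Vec n → ℝ) (η : ℕ → ℝ) {φ₀ : Vec n}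
    (hφ₀ : φ₀ ∈ feasible n) (w : ℕ → Vec n) : ∀ k, iterate L η φ₀ w k ∈ feasible n
  | 0 => hφ₀
  | _ + 1 => proj_mem _

theorem iterate_congr {n : ℕ} (L : Vec n → ℝ) (η : ℕ → ℝ) (φ₀ : Vec n) {w w' : ℕ → Vec n} {k : ℕ}
    (h : ∀ i ≤ k, w i = w' i) : iterate L η φ₀ w k = iterate L η φ₀ w' k := by
  induction k with
  | zero => rfl
  | succ k ih =>
    rw [iterate, iterate, ih fun i hi => h i (by omega), h (k + 1) le_rfl]

/-- An iterate is independent of the noise of all later steps. -/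
theorem indepFun_iterate_noise {n : ℕ} (σ : ℝ) {L : Vec n → ℝ} (hL : ContDiff ℝ 1 L) (η : ℕ → ℝ)
    (φ₀ : Vec n) {j k : ℕ} (hjk : j < k) :
    IndepFun (fun w => iterate L η φ₀ w j) (fun w => w k) (noiseLaw n σ) := by
  have hi : iIndepFun (fun (i : ℕ) (w : ℕ → Vec n) => w i) (noiseLaw n σ) :=
    iIndepFun_infinitePi (X := fun _ ω => ω) (by fun_prop)
  have h := hi.indepFun_finset (Finset.range (j + 1)) {k} (by simp; omega) (by fun_prop)
  -- Extending a finite noise sequence by zeros exhibits the iterate as a function of it.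
  let E : (Finset.range (j + 1) → Vec n) → ℕ → Vec n :=
    fun v i => if hi : i ∈ Finset.range (j + 1) then v ⟨i, hi⟩ else 0
  have hE : Measurable E := by
    refine measurable_pi_iff.2 fun i => ?_
    by_cases hi : i ∈ Finset.range (j + 1)
    · simp only [E, hi, dite_true]; fun_prop
    · simp only [E, hi, dite_false]; fun_prop
  have h2 := h.comp ((measurable_iterate L hL η φ₀ j).comp hE)
    (measurable_pi_apply (⟨k, by simp⟩ : ({k} : Finset ℕ)))
  convert! h2 using 1
  ext1 w
  refine iterate_congr L η φ₀ fun i hi => ?_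
  simp [E, hi.not_gt]

instance isProbabilityMeasure_noiseLaw (n : ℕ) (σ : ℝ) : IsProbabilityMeasure (noiseLaw n σ) := by
  unfold noiseLaw; infer_instance

theorem noiseLaw_map_eval (n : ℕ) (σ : ℝ) (k : ℕ) :
    (noiseLaw n σ).map (fun w => w k)
      = multivariateGaussian (0 : Vec n) (σ ^ 2 • (1 : Matrix _ _ ℝ)) :=
  Measure.infinitePi_map_eval _ k

theorem measurable_proj {n : ℕ} : Measurable (proj : Vec n → Vec n) := by unfold proj; fun_prop

theorem measurable_gradient {n : ℕ} {L : Vec n → ℝ} (hL : ContDiff ℝ 1 L) : Measurable (∇ L) :=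
  ((InnerProductSpace.toDual ℝ (Vec n)).symm.continuous.comp
    (hL.continuous_fderiv one_ne_zero)).measurable

theorem measurable_noisyStep {n : ℕ} {L : Vec n → ℝ} (hL : ContDiff ℝ 1 L) (t : ℝ) :
    Measurable fun z : Vec n × Vec n => proj (z.1 - t • (∇ L z.1 + z.2)) := by
  have := measurable_gradient hL
  exact measurable_proj.comp (by fun_prop)

theorem map_iterate_succ {n : ℕ} (σ : ℝ) {L : Vec n → ℝ} (hL : ContDiff ℝ 1 L) (η : ℕ → ℝ)
    (φ₀ : Vec n) (k : ℕ) :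
    (noiseLaw n σ).map (fun w => iterate L η φ₀ w (k + 1))
      = (((noiseLaw n σ).map fun w => iterate L η φ₀ w k).prod
          (multivariateGaussian (0 : Vec n) (σ ^ 2 • (1 : Matrix _ _ ℝ)))).map
        fun z => proj (z.1 - η (k + 1) • (∇ L z.1 + z.2)) := by
  have hm := measurable_iterate L hL η φ₀ k
  rw [← noiseLaw_map_eval n σ (k + 1),
    ← (indepFun_iff_map_prod_eq_prod_map_map hm.aemeasurable
      (measurable_pi_apply (k + 1)).aemeasurable).1
      (indepFun_iterate_noise σ hL η φ₀ (Nat.lt_succ_self k)),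
    Measure.map_map (measurable_noisyStep hL _) (hm.prodMk (measurable_pi_apply _))]
  rfl

/-- Adaptive composition of the Gaussian mechanism along the iterations: every step multiplies the
Rényi bound by the factor of a single Gaussian release, and projection is post-processing. -/
theorem renyiDom_iterate {n : ℕ} {p q : ℝ} (hpq : p.HolderConjugate q) {σ Δ : ℝ} (hσ : 0 < σ)
    {L L' : Vec n → ℝ} (hL : ContDiff ℝ 1 L) (hL' : ContDiff ℝ 1 L')
    (hΔ : ∀ φ ∈ feasible n, ‖∇ L φ - ∇ L' φ‖ ≤ Δ) (η : ℕ → ℝ) {φ₀ : Vec n}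
    (hφ₀ : φ₀ ∈ feasible n) (k : ℕ) :
    RenyiDom q (ENNReal.ofReal (Real.exp ((p - 1) / 2 * (k * (Δ ^ 2 / σ ^ 2)))))
      ((noiseLaw n σ).map fun w => iterate L η φ₀ w k)
      ((noiseLaw n σ).map fun w => iterate L' η φ₀ w k) := by
  induction k with
  | zero =>
    simpa [iterate] using RenyiDom.refl hpq (Measure.dirac φ₀)
  | succ k ih =>
    rw [map_iterate_succ σ hL, map_iterate_succ σ hL']
    refine (ih.map_prod hpq.symm.pos
      (K' := ENNReal.ofReal (Real.exp ((p - 1) / 2 * (Δ ^ 2 / σ ^ 2))))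
      (measurable_noisyStep hL _) (measurable_noisyStep hL' _) ?_).mono ?_
    · have hfeas : MeasurableSet {φ : Vec n | φ ∈ feasible n} :=
        measurableSet_le measurable_norm measurable_const
      have hae : ∀ᵐ φ ∂((noiseLaw n σ).map fun w => iterate L η φ₀ w k), φ ∈ feasible n :=
        (ae_map_iff (measurable_iterate L hL η φ₀ k).aemeasurable hfeas).2
          (Filter.Eventually.of_forall fun w => iterate_mem_feasible L η hφ₀ w k)
      filter_upwards [hae] with φ hφ
      have hs : Measurable fun y : Vec n => proj (φ - η (k + 1) • y) :=
        measurable_proj.comp (by fun_prop)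
      have := (renyiDom_multivariateGaussian hpq hσ (hΔ φ hφ)).map hs
      rwa [Measure.map_map hs (by fun_prop), Measure.map_map hs (by fun_prop)] at this
    · rw [← ENNReal.ofReal_mul (by positivity), ← Real.exp_add]
      refine le_of_eq ?_
      congr 2
      push_cast
      ring

/-! ### Privacy -/

/-- A lower bound on the product of the two logarithms in the noise level. For `δ` near `1`, where
`log (1 / δ)` is of no use, the summand `log 2` of `log (T / δ)` compensates for `ε / 2 ≤ 1 / 2`. -/
theorem half_add_log_le_two_mul_log_mul_log {T : ℕ} (hT : 2 ≤ T) {ε δ : ℝ} (hε : 0 < ε)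
    (hδ : 0 < δ) (hδ1 : δ < 1) (hεδ : ε ≤ max 1 (2 * Real.log (1 / δ))) :
    ε / 2 + Real.log (1 / δ)
      ≤ 2 * (Real.log (Real.exp 1 + √(T : ℝ) * ε / δ) * Real.log (T / δ)) := by
  have hT' : (2 : ℝ) ≤ T := by exact_mod_cast hT
  have hl : 0 < Real.log (1 / δ) := Real.log_pos (by rw [one_div]; exact (one_lt_inv₀ hδ).2 hδ1)
  have hA : 1 ≤ Real.log (Real.exp 1 + √(T : ℝ) * ε / δ) := by
    rw [Real.le_log_iff_exp_le (by positivity)]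
    linarith [show 0 ≤ √(T : ℝ) * ε / δ by positivity]
  have hB : Real.log 2 + Real.log (1 / δ) ≤ Real.log (T / δ) := by
    rw [← Real.log_mul two_ne_zero (by positivity), mul_one_div]
    exact Real.log_le_log (by positivity) (by gcongr)
  have hε' : ε ≤ 1 + 2 * Real.log (1 / δ) :=
    hεδ.trans (max_le (by linarith) (by linarith))
  nlinarith [Real.log_two_gt_d9]

theorem sq_noiseLevel {m T : ℕ} {ε δ : ℝ}
    (h : 0 ≤ Real.log (Real.exp 1 + √(T : ℝ) * ε / δ) * Real.log (T / δ)) :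
    noiseLevel m T ε δ ^ 2 = 16 * T *
      (Real.log (Real.exp 1 + √(T : ℝ) * ε / δ) * Real.log (T / δ)) / (m * ε) ^ 2 := by
  rw [noiseLevel, mul_pow, Real.sq_sqrt (by rw [mul_assoc]; positivity), div_pow]
  ring

theorem isDifferentiallyPrivate_explanationLaw {n m T : ℕ} {f : Vec n → ℝ} {z : Vec n}
    {α : ℝ≥0 → ℝ≥0} (η : ℕ → ℝ) {φ₀ : Vec n} {ε δ : ℝ} (hm : 0 < m) (hT : 1 ≤ T)
    (hf : ∀ x, |f x| ≤ 1) (hα : α ∈ weightFamily 1 z) (hφ₀ : φ₀ ∈ feasible n) (hε : 0 < ε)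
    (hδ : 0 < δ) (hεδ : ε ≤ max 1 (2 * Real.log (1 / δ))) :
    IsDifferentiallyPrivate m ε δ fun X => explanationLaw α f z m T ε δ η φ₀ X := by
  intro X X' hXX hcard S hS
  have hP := isProbabilityMeasure_explanationLaw α f z m T ε δ η φ₀ X
  have hQ := isProbabilityMeasure_explanationLaw α f z m T ε δ η φ₀ X'
  rcases le_or_gt 1 δ with hδ1 | hδ1
  · calc _ ≤ (1 : ℝ≥0∞) := prob_le_one
      _ ≤ ENNReal.ofReal δ := by simpa using hδ1
      _ ≤ _ := le_add_self
  -- For `T = 1` no noise is added, and the output is `φ₀` whatever the dataset.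
  rcases hT.eq_or_lt with rfl | hT2
  · have h1 : explanationLaw α f z m 1 ε δ η φ₀ X = explanationLaw α f z m 1 ε δ η φ₀ X' := rfl
    have h2 : (1 : ℝ≥0∞) ≤ ENNReal.ofReal (Real.exp ε) := by
      simpa using Real.one_le_exp hε.le
    simp only [h1]
    exact (le_mul_of_one_le_left zero_le h2).trans le_self_add
  have hl : 0 < Real.log (1 / δ) := Real.log_pos (by rw [one_div]; exact (one_lt_inv₀ hδ).2 hδ1)
  have hD := half_add_log_le_two_mul_log_mul_log hT2 hε hδ hδ1 hεδ
  set D := Real.log (Real.exp 1 + √(T : ℝ) * ε / δ) * Real.log (T / δ) with hDdef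
  have hD0 : 0 < D := by linarith
  have hm' : (0 : ℝ) < m := by exact_mod_cast hm
  have hT' : (0 : ℝ) < T := by exact_mod_cast (by omega : 0 < T)
  have hσ2 : noiseLevel m T ε δ ^ 2 = 16 * T * D / (m * ε) ^ 2 := sq_noiseLevel hD0.le
  have hσ : 0 < noiseLevel m T ε δ := by
    have h0 : 0 ≤ noiseLevel m T ε δ := by unfold noiseLevel; positivity
    refine h0.lt_of_ne fun h => ?_
    rw [← h] at hσ2
    have : 0 < 16 * T * D / (m * ε) ^ 2 := by positivity
    simp at hσ2
    grind
  -- The privacy losses of all steps have total variance at most `V`; this `lam` minimizes the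
  -- expression `lam (lam + 1) V / 2 - ε lam` of the conversion to `(ε, δ)`-privacy.
  set V := ε ^ 2 / (4 * D) with hVdef
  set lam := 4 * D / ε - 1 / 2 with hlamdef
  have hlam : 0 < lam := by
    rw [hlamdef, sub_pos, lt_div_iff₀ hε]
    linarith
  have hpq : (lam + 1).HolderConjugate ((lam + 1) / lam) := by
    rw [Real.holderConjugate_iff]
    refine ⟨by linarith, ?_⟩
    field_simp
    ring
  have hdom := renyiDom_iterate hpq hσ (contDiff_localLoss α f z X) (contDiff_localLoss α f z X')
    (fun φ hφ => norm_gradient_sub_le_of_neighbouring hf hα hφ hm hXX hcard) η hφ₀ (T - 1)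
  refine RenyiDom.le_exp_mul_add (P := explanationLaw α f z m T ε δ η φ₀ X)
    (Q := explanationLaw α f z m T ε δ η φ₀ X') (V := V) hlam hδ (hdom.mono ?_) ?_ hS
  · refine ENNReal.ofReal_le_ofReal (Real.exp_le_exp.2 ?_)
    rw [add_sub_cancel_right]
    refine mul_le_mul_of_nonneg_left ?_ (by positivity)
    rw [hσ2, Nat.cast_sub hT, Nat.cast_one]
    have : (T : ℝ) * ((2 / (m : ℝ)) ^ 2 / (16 * T * D / (m * ε) ^ 2)) = V := by
      rw [hVdef]; field_simp; ring
    rw [← this]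
    gcongr
    linarith
  · have : lam * (lam + 1) * V / 2 - ε * lam = -2 * D + ε / 2 - ε ^ 2 / (32 * D) := by
      rw [hVdef, hlamdef]; field_simp; ring
    rw [this]
    have : 0 ≤ ε ^ 2 / (32 * D) := by positivity
    linarith

/-! ### One step of noisy gradient descent in expectation -/

theorem memLp_two_noise (n : ℕ) (σ : ℝ) (k : ℕ) :
    MemLp (fun w : ℕ → Vec n => w k) 2 (noiseLaw n σ) := by
  have h : MemLp id 2 ((noiseLaw n σ).map fun w => w k) := by
    rw [noiseLaw_map_eval]
    exact IsGaussian.memLp_two_id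
  exact h.comp_of_map (measurable_pi_apply k).aemeasurable

theorem integral_norm_noise_sq (n : ℕ) (σ : ℝ) (k : ℕ) :
    ∫ w, ‖w k‖ ^ 2 ∂(noiseLaw n σ) = n * σ ^ 2 := by
  have hS : (σ ^ 2 • (1 : Matrix (Fin n) (Fin n) ℝ)).PosSemidef :=
    Matrix.PosSemidef.one.smul (sq_nonneg σ)
  have h1 : ∫ w, ‖w k‖ ^ 2 ∂(noiseLaw n σ)
      = ∫ y, ‖y‖ ^ 2 ∂(multivariateGaussian (0 : Vec n) (σ ^ 2 • (1 : Matrix _ _ ℝ))) := by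
    rw [← noiseLaw_map_eval n σ k, integral_map (measurable_pi_apply k).aemeasurable (by fun_prop)]
  have hcoord : ∀ i : Fin n, MemLp (fun y : Vec n => y i) 2
      (multivariateGaussian (0 : Vec n) (σ ^ 2 • (1 : Matrix _ _ ℝ))) := fun i =>
    (EuclideanSpace.proj (𝕜 := ℝ) i).comp_memLp' IsGaussian.memLp_two_id
  rw [h1]
  simp_rw [EuclideanSpace.real_norm_sq_eq]
  rw [integral_finsetSum _ fun i _ => (hcoord i).integrable_sq]
  have h2 : ∀ i : Fin n, ∫ y : Vec n, y i ^ 2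
      ∂(multivariateGaussian (0 : Vec n) (σ ^ 2 • (1 : Matrix _ _ ℝ))) = σ ^ 2 := by
    intro i
    have hv := variance_eval_multivariateGaussian (μ := (0 : Vec n)) hS i
    have hm : ∫ y : Vec n, y i ∂(multivariateGaussian (0 : Vec n) (σ ^ 2 • (1 : Matrix _ _ ℝ)))
        = 0 := by
      have := (EuclideanSpace.proj (𝕜 := ℝ) i).integral_comp_comm (μ :=
        multivariateGaussian (0 : Vec n) (σ ^ 2 • (1 : Matrix _ _ ℝ))) IsGaussian.integrable_id
      simpa using this
    rw [variance_of_integral_eq_zero (hcoord i).aemeasurable hm] at hv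
    simpa using hv
  simp [h2]

theorem integral_inner_noise_eq_zero {n : ℕ} {σ : ℝ} {k : ℕ} {Y : (ℕ → Vec n) → Vec n}
    (hY : Measurable Y) (hYb : ∀ w, Y w ∈ feasible n)
    (hind : IndepFun Y (fun w => w k) (noiseLaw n σ)) :
    Integrable (fun w => inner ℝ (w k) (Y w)) (noiseLaw n σ) ∧
      ∫ w, inner ℝ (w k) (Y w) ∂(noiseLaw n σ) = 0 := by
  have hint : Integrable (fun w => inner ℝ (w k) (Y w)) (noiseLaw n σ) := by
    refine ((memLp_two_noise n σ k).integrable one_le_two).norm.mono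
      (by fun_prop) (Filter.Eventually.of_forall fun w => ?_)
    rw [norm_norm]
    exact (norm_inner_le_norm _ _).trans (mul_le_of_le_one_right (norm_nonneg _) (hYb w))
  refine ⟨hint, ?_⟩
  have hk := measurable_pi_apply (X := fun _ : ℕ => Vec n) k
  have hpair := (indepFun_iff_map_prod_eq_prod_map_map hY.aemeasurable hk.aemeasurable).1 hind
  rw [noiseLaw_map_eval] at hpair
  have hmeas : AEStronglyMeasurable (fun z : Vec n × Vec n => inner ℝ z.2 z.1)
      ((noiseLaw n σ).map fun w => (Y w, w k)) := by fun_prop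
  have hint' : Integrable (fun z : Vec n × Vec n => inner ℝ z.2 z.1)
      ((noiseLaw n σ).map fun w => (Y w, w k)) :=
    (integrable_map_measure hmeas (hY.prodMk hk).aemeasurable).2 hint
  have h1 : ∫ w, inner ℝ (w k) (Y w) ∂(noiseLaw n σ)
      = ∫ z : Vec n × Vec n, inner ℝ z.2 z.1 ∂((noiseLaw n σ).map fun w => (Y w, w k)) :=
    (integral_map (hY.prodMk hk).aemeasurable hmeas).symm
  have : IsProbabilityMeasure ((noiseLaw n σ).map Y) :=
    Measure.isProbabilityMeasure_map hY.aemeasurable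
  rw [hpair] at h1 hint'
  rw [h1, integral_prod _ hint']
  refine integral_eq_zero_of_ae (Filter.Eventually.of_forall fun y => ?_)
  have := integral_inner (𝕜 := ℝ) (μ := multivariateGaussian (0 : Vec n)
    (σ ^ 2 • (1 : Matrix _ _ ℝ))) IsGaussian.integrable_id y
  simpa [real_inner_comm] using this

theorem integrable_comp_of_mem_feasible {n : ℕ} {σ : ℝ} {L : Vec n → ℝ} (hL : ContDiff ℝ 1 L)
    {Y : (ℕ → Vec n) → Vec n} (hY : Measurable Y) (hYb : ∀ w, Y w ∈ feasible n) :
    Integrable (fun w => L (Y w)) (noiseLaw n σ) := by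
  obtain ⟨C, hC⟩ := (isCompact_closedBall (0 : Vec n) 1).exists_bound_of_continuousOn
    hL.continuous.continuousOn
  refine Integrable.of_bound (hL.continuous.measurable.comp hY).aestronglyMeasurable C
    (Filter.Eventually.of_forall fun w => hC _ ?_)
  exact mem_closedBall_zero_iff.2 (hYb w)

theorem norm_sub_sq_le_four {n : ℕ} {φ ψ : Vec n} (hφ : φ ∈ feasible n) (hψ : ψ ∈ feasible n) :
    ‖φ - ψ‖ ^ 2 ≤ 4 := by
  have h1 : ‖φ‖ ≤ 1 := hφ
  have h2 : ‖ψ‖ ≤ 1 := hψ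
  have h3 := norm_sub_le φ ψ
  nlinarith [norm_nonneg (φ - ψ)]

theorem integrable_norm_sub_sq {n : ℕ} {σ : ℝ} {Y Z : (ℕ → Vec n) → Vec n} (hY : Measurable Y)
    (hZ : Measurable Z) (hYb : ∀ w, Y w ∈ feasible n) (hZb : ∀ w, Z w ∈ feasible n) :
    Integrable (fun w => ‖Y w - Z w‖ ^ 2) (noiseLaw n σ) := by
  refine Integrable.of_bound (by fun_prop) 4 (Filter.Eventually.of_forall fun w => ?_)
  rw [Real.norm_of_nonneg (by positivity)]
  exact norm_sub_sq_le_four (hYb w) (hZb w)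

/-- One step of projected gradient descent, compared with a feasible point `ψ`. -/
theorem two_mul_sub_le_of_proj {n : ℕ} {L : Vec n → ℝ} {φ ψ y : Vec n} {t : ℝ} (ht : 0 ≤ t)
    (hφ : ‖∇ L φ‖ ≤ 1) (hψ : ψ ∈ feasible n) (hconv : L φ - L ψ ≤ inner ℝ (∇ L φ) (φ - ψ)) :
    2 * t * (L φ - L ψ) ≤ ‖φ - ψ‖ ^ 2 - ‖proj (φ - t • (∇ L φ + y)) - ψ‖ ^ 2
      - 2 * t * (inner ℝ y φ - inner ℝ y ψ) + t ^ 2 * (2 + 2 * ‖y‖ ^ 2) := by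
  have h1 := proj_spec (φ - t • (∇ L φ + y)) ψ hψ
  have h2 : ψ - (φ - t • (∇ L φ + y)) = t • (∇ L φ + y) - (φ - ψ) := by abel
  rw [h2, norm_sub_sq_real (t • (∇ L φ + y)), norm_smul, inner_smul_left, inner_add_left, mul_pow, Real.norm_eq_abs,
    sq_abs, norm_sub_rev ψ] at h1
  have h3 : ‖∇ L φ + y‖ ^ 2 ≤ 2 + 2 * ‖y‖ ^ 2 := by
    have := norm_add_le (∇ L φ) y
    nlinarith [norm_nonneg (∇ L φ), norm_nonneg y, norm_nonneg (∇ L φ + y),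
      sq_nonneg (‖∇ L φ‖ - ‖y‖)]
  have h4 := mul_le_mul_of_nonneg_left h3 (sq_nonneg t)
  have h5 := mul_le_mul_of_nonneg_left hconv ht
  have h6 := sq_nonneg ‖proj (φ - t • (∇ L φ + y)) - (φ - t • (∇ L φ + y))‖
  rw [inner_sub_right y] at h1
  simp only [conj_trivial] at h1
  linarith

/-- The expected version of a step. The comparison point may be random, as long as it does not
depend on the noise of this step. -/
theorem integral_step_le {n : ℕ} {σ : ℝ} {L : Vec n → ℝ} (hL : ContDiff ℝ 1 L)
    (hg : ∀ φ ∈ feasible n, ‖∇ L φ‖ ≤ 1)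
    (hconv : ∀ φ ψ, L φ - L ψ ≤ inner ℝ (∇ L φ) (φ - ψ)) (η : ℕ → ℝ) {φ₀ : Vec n}
    (hφ₀ : φ₀ ∈ feasible n) (k : ℕ) (hη : 0 ≤ η (k + 1)) {Y : (ℕ → Vec n) → Vec n}
    (hY : Measurable Y) (hYb : ∀ w, Y w ∈ feasible n)
    (hind : IndepFun Y (fun w => w (k + 1)) (noiseLaw n σ)) :
    2 * η (k + 1) * (∫ w, L (iterate L η φ₀ w k) ∂(noiseLaw n σ) - ∫ w, L (Y w) ∂(noiseLaw n σ))
      ≤ ∫ w, ‖iterate L η φ₀ w k - Y w‖ ^ 2 ∂(noiseLaw n σ)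
        - ∫ w, ‖iterate L η φ₀ w (k + 1) - Y w‖ ^ 2 ∂(noiseLaw n σ)
        + η (k + 1) ^ 2 * (2 + 2 * (n * σ ^ 2)) := by
  have hm := measurable_iterate L hL η φ₀
  have hf := fun k w => iterate_mem_feasible L η hφ₀ w k
  have i1 := integrable_comp_of_mem_feasible (σ := σ) hL (hm k) (hf k)
  have i2 := integrable_comp_of_mem_feasible (σ := σ) hL hY hYb
  have i3 := integrable_norm_sub_sq (σ := σ) (hm k) hY (hf k) hYb
  have i4 := integrable_norm_sub_sq (σ := σ) (hm (k + 1)) hY (hf (k + 1)) hYb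
  obtain ⟨i5, e5⟩ := integral_inner_noise_eq_zero (σ := σ) (hm k) (hf k)
    (indepFun_iterate_noise σ hL η φ₀ (Nat.lt_succ_self k))
  obtain ⟨i6, e6⟩ := integral_inner_noise_eq_zero hY hYb hind
  have i7 : Integrable (fun w : ℕ → Vec n => ‖w (k + 1)‖ ^ 2) (noiseLaw n σ) :=
    (memLp_two_noise n σ (k + 1)).integrable_norm_pow two_ne_zero
  have i34 := i3.sub i4
  have i56 := (i5.sub i6).const_mul (2 * η (k + 1))
  have i7' := ((integrable_const (2 : ℝ)).add (i7.const_mul 2)).const_mul (η (k + 1) ^ 2)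
  have key := integral_mono ((i1.sub i2).const_mul (2 * η (k + 1))) ((i34.sub i56).add i7')
    fun w => two_mul_sub_le_of_proj (y := w (k + 1)) hη (hg _ (hf k w)) (hYb w) (hconv _ _)
  rw [integral_const_mul, integral_sub' i1 i2, integral_add' (i34.sub i56) i7',
    integral_sub' i34 i56, integral_sub' i3 i4, integral_const_mul, integral_sub' i5 i6,
    integral_const_mul, integral_add' (integrable_const _) (i7.const_mul 2), integral_const_mul,
    e5, e6, integral_norm_noise_sq] at key
  simpa [iterate] using key

/-! ### Last-iterate convergence -/

/-- Sum over a window of steps of the errors relative to a value `b`, where `e k` is the squared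
distance of the `k`-th iterate from a point of value `b`. -/
theorem sum_window_le {a e : ℕ → ℝ} {b c D G : ℝ} (hc : 0 < c) (hG : 0 ≤ G) (he : ∀ k, e k ≤ D)
    {j N : ℕ} (hjN : j ≤ N)
    (hstep : ∀ k, j ≤ k → 2 * (c / √(k + 1 : ℝ)) * (a k - b)
      ≤ e k - e (k + 1) + (c / √(k + 1 : ℝ)) ^ 2 * G) :
    ∑ k ∈ Finset.Icc j N, (a k - b) + e (N + 1) * √(N + 1 : ℝ) / (2 * c)
      ≤ (D * (√(N + 1 : ℝ) - √(j + 1 : ℝ)) + e j * √(j + 1 : ℝ)) / (2 * c)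
        + c * G * (√(N + 1 : ℝ) - √(j : ℝ)) := by
  have hone : ∀ k : ℕ, j ≤ k → a k - b ≤ (e k - e (k + 1)) * √(k + 1 : ℝ) / (2 * c)
      + c * G * (√(k + 1 : ℝ) - √(k : ℝ)) := by
    intro k hk
    have hr : 0 < √(k + 1 : ℝ) := by positivity
    have hs : √(k : ℝ) ≤ √(k + 1 : ℝ) := Real.sqrt_le_sqrt (by linarith)
    have h1 : 1 / (2 * √(k + 1 : ℝ)) ≤ √(k + 1 : ℝ) - √(k : ℝ) := by
      rw [div_le_iff₀ (by positivity)]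
      have e1 := Real.sq_sqrt (show (0 : ℝ) ≤ k + 1 by positivity)
      have e2 := Real.sq_sqrt (show (0 : ℝ) ≤ k by positivity)
      nlinarith [Real.sqrt_nonneg (k : ℝ)]
    have h2 := mul_le_mul_of_nonneg_left h1 (mul_nonneg hc.le hG)
    refine le_trans ?_ (add_le_add_right h2 _)
    have h3 := hstep k hk
    have h4 : (a k - b) = (2 * (c / √(k + 1 : ℝ)) * (a k - b)) * (√(k + 1 : ℝ) / (2 * c)) := by
      field_simp
    rw [h4]
    refine (mul_le_mul_of_nonneg_right h3 (by positivity)).trans (le_of_eq ?_)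
    field_simp
  induction N, hjN using Nat.le_induction with
  | base =>
    rw [Finset.Icc_self, Finset.sum_singleton]
    have := hone j le_rfl
    simp only [sub_self, mul_zero, zero_add]
    rw [sub_mul, sub_div] at this
    linarith
  | succ N hjN ih =>
    rw [← Finset.insert_Icc_right_eq_Icc_add_one (by omega), Finset.sum_insert (by simp)]
    have h1 := hone (N + 1) (by omega)
    have hs : √(N + 1 : ℝ) ≤ √((N + 1 : ℕ) + 1 : ℝ) := Real.sqrt_le_sqrt (by push_cast; linarith)
    have h2 := div_le_div_of_nonneg_right
      (mul_le_mul_of_nonneg_right (he (N + 1)) (sub_nonneg.2 hs)) (by positivity : 0 ≤ 2 * c)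
    have h3 : √((N + 1 : ℕ) : ℝ) = √(N + 1 : ℝ) := by push_cast; rfl
    rw [h3] at h1
    ring_nf at h1 h2 ih ⊢
    linarith

/-- If the average over each window ending at `N` exceeds the value at the start of the window by at
most `B`, then shrinking the window from `k + 2` to `k + 1` steps raises its average by at most
`B / (k + 1)`; hence the last value exceeds the averages by at most `B` times a harmonic sum. -/
theorem last_le_average_add {a : ℕ → ℝ} {B : ℝ} {N : ℕ}
    (h : ∀ k ≤ N, ∑ i ∈ Finset.Icc (N - k) N, (a i - a (N - k)) ≤ B * (k + 1)) {k : ℕ}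
    (hk : k ≤ N) :
    a N ≤ (∑ i ∈ Finset.Icc (N - k) N, a i) / (k + 1) + B * harmonic k := by
  induction k with
  | zero => simp
  | succ k ih =>
    have hins : Finset.Icc (N - (k + 1)) N = insert (N - (k + 1)) (Finset.Icc (N - k) N) := by
      ext i; simp; omega
    have hnot : N - (k + 1) ∉ Finset.Icc (N - k) N := by simp; omega
    have h1 := h (k + 1) hk
    rw [Finset.sum_sub_distrib, Finset.sum_const, Nat.card_Icc,
      show N + 1 - (N - (k + 1)) = k + 2 by omega, nsmul_eq_mul, hins,
      Finset.sum_insert hnot] at h1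
    rw [hins, Finset.sum_insert hnot, harmonic_succ]
    have h2 := ih (by omega)
    set U := ∑ i ∈ Finset.Icc (N - k) N, a i
    set x := a (N - (k + 1))
    push_cast at h1 ⊢
    have h3 : U / (k + 1) ≤ (x + U) / (k + 1 + 1) + B * ((k : ℝ) + 1)⁻¹ := by
      have : (x + U) / ((k : ℝ) + 1 + 1) + B * ((k : ℝ) + 1)⁻¹ - U / (k + 1)
          = (B * (k + 2) - (U - (k + 1) * x)) / ((k + 1) * (k + 2)) := by
        field_simp; ring
      have h4 : 0 ≤ (B * (k + 2) - (U - (k + 1) * x)) / (((k : ℝ) + 1) * (k + 2)) := by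
        apply div_nonneg _ (by positivity)
        linarith
      linarith
    rw [mul_add]
    linarith

/-- Convergence of the last iterate of stochastic gradient descent with steps `c / √t`. Here `a k` is
the expected value at the `k`-th iterate, `b` the optimal value, `e k` the expected squared distance
of the `k`-th iterate from an optimum, and `d j k` that from the `j`-th iterate. The comparison with
the iterate at the start of a window, where `d j j = 0`, gives the hypothesis of
`last_le_average_add`; the comparison with the optimum bounds the average over all steps. -/
theorem last_iterate_le {a e : ℕ → ℝ} {d : ℕ → ℕ → ℝ} {b c D G : ℝ} (hc : 0 < c) (hD : 0 ≤ D)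
    (hG : 0 ≤ G)
    (he0 : ∀ k, 0 ≤ e k) (heD : ∀ k, e k ≤ D) (hd0 : ∀ j k, 0 ≤ d j k) (hdD : ∀ j k, d j k ≤ D)
    (hdd : ∀ j, d j j = 0)
    (hopt : ∀ k : ℕ, 2 * (c / √(k + 1 : ℝ)) * (a k - b)
      ≤ e k - e (k + 1) + (c / √(k + 1 : ℝ)) ^ 2 * G)
    (hpast : ∀ j k : ℕ, j ≤ k → 2 * (c / √(k + 1 : ℝ)) * (a k - a j)
      ≤ d j k - d j (k + 1) + (c / √(k + 1 : ℝ)) ^ 2 * G) (N : ℕ) :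
    a N - b ≤ (D / (2 * c) + c * G) / √(N + 1 : ℝ) * (1 + harmonic N) := by
  have hr : 0 < √(N + 1 : ℝ) := by positivity
  have hr2 : √(N + 1 : ℝ) ^ 2 = N + 1 := Real.sq_sqrt (by positivity)
  set A := D / (2 * c) + c * G with hA
  have hA0 : 0 ≤ A := by positivity
  have hwin : ∀ k ≤ N, ∑ i ∈ Finset.Icc (N - k) N, (a i - a (N - k))
      ≤ A / √(N + 1 : ℝ) * (k + 1) := by
    intro k hk
    have h1 := sum_window_le hc hG (hdD (N - k)) (Nat.sub_le N k) (hpast (N - k))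
    rw [hdd] at h1
    have h2 : 0 ≤ d (N - k) (N + 1) * √(N + 1 : ℝ) / (2 * c) := by
      have := hd0 (N - k) (N + 1); positivity
    have hs : √((N - k : ℕ) : ℝ) ≤ √((N - k : ℕ) + 1 : ℝ) := Real.sqrt_le_sqrt (by linarith)
    have h3 : √(N + 1 : ℝ) - √((N - k : ℕ) : ℝ) ≤ (k + 1) / √(N + 1 : ℝ) := by
      rw [le_div_iff₀ hr]
      have e2 := Real.sq_sqrt (show (0 : ℝ) ≤ (N - k : ℕ) by positivity)
      rw [Nat.cast_sub hk] at e2 ⊢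
      have hle : √((N : ℝ) - k) ≤ √(N + 1 : ℝ) :=
        Real.sqrt_le_sqrt (by linarith [show (0 : ℝ) ≤ k by positivity])
      nlinarith [Real.sqrt_nonneg ((N : ℝ) - k)]
    have h4 : (D * (√(N + 1 : ℝ) - √((N - k : ℕ) + 1 : ℝ)) + 0 * √((N - k : ℕ) + 1 : ℝ)) / (2 * c)
        ≤ D / (2 * c) * (√(N + 1 : ℝ) - √((N - k : ℕ) : ℝ)) := by
      rw [zero_mul, add_zero, mul_div_right_comm]
      gcongr
    have h5 := mul_le_mul_of_nonneg_left h3 hA0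
    rw [hA, add_mul, ← hA] at h5
    calc _ ≤ A * ((k + 1) / √(N + 1 : ℝ)) := by linarith
      _ = _ := by ring
  have h1 := last_le_average_add hwin le_rfl
  have h2 := sum_window_le hc hG heD (Nat.zero_le N) fun k _ => hopt k
  rw [Nat.sub_self] at h1
  rw [Finset.sum_sub_distrib, Finset.sum_const, Nat.card_Icc, nsmul_eq_mul] at h2
  have h3 : 0 ≤ e (N + 1) * √(N + 1 : ℝ) / (2 * c) := by
    have := he0 (N + 1); positivity
  have h4 : (D * (√(N + 1 : ℝ) - √((0 : ℕ) + 1 : ℝ)) + e 0 * √((0 : ℕ) + 1 : ℝ)) / (2 * c)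
      + c * G * (√(N + 1 : ℝ) - √((0 : ℕ) : ℝ)) ≤ A * √(N + 1 : ℝ) := by
    have : (D * (√(N + 1 : ℝ) - 1) + e 0 * 1) / (2 * c) ≤ D * √(N + 1 : ℝ) / (2 * c) := by
      gcongr
      linarith [heD 0]
    simp only [Nat.cast_zero, zero_add, Real.sqrt_one, Real.sqrt_zero, sub_zero, hA]
    linarith [this, add_mul (D / (2 * c)) (c * G) (√(N + 1 : ℝ)),
      mul_div_right_comm D (√(N + 1 : ℝ)) (2 * c)]
  have h5 : (∑ i ∈ Finset.Icc 0 N, a i) / (N + 1) ≤ b + A / √(N + 1 : ℝ) := by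
    rw [div_le_iff₀ (by positivity)]
    have : (b + A / √(N + 1 : ℝ)) * (N + 1) = (N + 1) * b + A * √(N + 1 : ℝ) := by
      rw [add_mul, div_mul_eq_mul_div, (div_eq_iff hr.ne').2 (by
        rw [mul_assoc, ← pow_two, hr2] : A * (N + 1 : ℝ) = A * √(N + 1 : ℝ) * √(N + 1 : ℝ))]
      ring
    rw [this]
    simp only [Nat.sub_zero] at h2
    push_cast at h2 h4
    linarith
  rw [mul_add, mul_one]
  linarith

/-! ### Utility -/

theorem excessLossLE_explanationLaw {n m T : ℕ} {f : Vec n → ℝ} {z : Vec n}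
    {α : ℝ≥0 → ℝ≥0} {c : ℝ} {φ₀ : Vec n} {ε δ : ℝ} (X : Multiset (Vec n)) (hT : 2 ≤ T)
    (hf : ∀ x, |f x| ≤ 1) (hα : α ∈ weightFamily 1 z) (hφ₀ : φ₀ ∈ feasible n) (hc : 0 < c)
    (hσ : n * noiseLevel m T ε δ ^ 2 ≤ 3) :
    ExcessLossLE (localLoss α f z X)
      (explanationLaw α f z m T ε δ (fun t => c / √(t : ℝ)) φ₀ X)
      (32 * (c + 1 / c) * (Real.log T / √(T : ℝ))) := by
  set σ := noiseLevel m T ε δ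
  set L := localLoss α f z X
  set η : ℕ → ℝ := fun t => c / √(t : ℝ) with hη
  have hL : ContDiff ℝ 1 L := contDiff_localLoss α f z X
  have hm := measurable_iterate L hL η φ₀
  have hfeas := fun k w => iterate_mem_feasible L η hφ₀ w k
  have hLm : ∀ ν : Measure (Vec n), AEStronglyMeasurable L ν := fun ν =>
    hL.continuous.aestronglyMeasurable
  have hint := integrable_comp_of_mem_feasible (σ := σ) hL (hm (T - 1)) (hfeas (T - 1))
  refine ⟨(integrable_map_measure (hLm _) (hm (T - 1)).aemeasurable).2 hint, fun φs hφs => ?_⟩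
  rw [explanationLaw, integral_map (hm (T - 1)).aemeasurable (hLm _)]
  have hstep : ∀ (k : ℕ) {Y : (ℕ → Vec n) → Vec n}, Measurable Y → (∀ w, Y w ∈ feasible n) →
      IndepFun Y (fun w => w (k + 1)) (noiseLaw n σ) →
      2 * (c / √(k + 1 : ℝ)) * (∫ w, L (iterate L η φ₀ w k) ∂(noiseLaw n σ)
          - ∫ w, L (Y w) ∂(noiseLaw n σ))
        ≤ ∫ w, ‖iterate L η φ₀ w k - Y w‖ ^ 2 ∂(noiseLaw n σ)
          - ∫ w, ‖iterate L η φ₀ w (k + 1) - Y w‖ ^ 2 ∂(noiseLaw n σ)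
          + (c / √(k + 1 : ℝ)) ^ 2 * 8 := by
    intro k Y hY hYb hind
    have hk : η (k + 1) = c / √(k + 1 : ℝ) := by simp [hη]
    have h1 := integral_step_le hL (fun φ hφ => norm_gradient_localLoss_le_one hf hα hφ X)
      (convex_localLoss_gradient_ineq α f z X) η hφ₀ k (by rw [hk]; positivity) hY hYb hind
    rw [hk] at h1
    refine h1.trans (add_le_add_right (mul_le_mul_of_nonneg_left ?_ (sq_nonneg _)) _)
    linarith
  have hle4 : ∀ {Y Z : (ℕ → Vec n) → Vec n}, Measurable Y → Measurable Z →
      (∀ w, Y w ∈ feasible n) → (∀ w, Z w ∈ feasible n) →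
      ∫ w, ‖Y w - Z w‖ ^ 2 ∂(noiseLaw n σ) ≤ 4 := by
    intro Y Z hY hZ hYb hZb
    have := integral_mono (integrable_norm_sub_sq (σ := σ) hY hZ hYb hZb) (integrable_const (4 : ℝ))
      fun w => norm_sub_sq_le_four (hYb w) (hZb w)
    simpa using this
  have key := last_iterate_le (a := fun k => ∫ w, L (iterate L η φ₀ w k) ∂(noiseLaw n σ))
    (e := fun k => ∫ w, ‖iterate L η φ₀ w k - φs‖ ^ 2 ∂(noiseLaw n σ))
    (d := fun j k => ∫ w, ‖iterate L η φ₀ w k - iterate L η φ₀ w j‖ ^ 2 ∂(noiseLaw n σ))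
    (b := L φs) (D := 4) (G := 8) hc (by norm_num) (by norm_num)
    (fun k => integral_nonneg fun w => by positivity)
    (fun k => hle4 (hm k) measurable_const (hfeas k) fun _ => hφs.1)
    (fun j k => integral_nonneg fun w => by positivity)
    (fun j k => hle4 (hm k) (hm j) (hfeas k) (hfeas j))
    (fun j => by simp)
    (fun k => by
      simpa using hstep k (Y := fun _ => φs) measurable_const (fun _ => hφs.1)
        (indepFun_const_left φs _))
    (fun j k hjk => hstep k (hm j) (hfeas j)
      (indepFun_iterate_noise σ hL η φ₀ (Nat.lt_succ_of_le hjk))) (T - 1)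
  refine key.trans ?_
  have hT' : (2 : ℝ) ≤ T := by exact_mod_cast hT
  have hcast : ((T - 1 : ℕ) : ℝ) + 1 = T := by
    rw [Nat.cast_sub (by omega)]; simp
  have hlog : Real.log 2 ≤ Real.log T := Real.log_le_log two_pos hT'
  have hharm : 1 + (harmonic (T - 1) : ℝ) ≤ 4 * Real.log T := by
    have h1 := harmonic_le_one_add_log (T - 1)
    have h2 : Real.log ((T - 1 : ℕ) : ℝ) ≤ Real.log T :=
      Real.log_le_log (by exact_mod_cast (by omega : 0 < T - 1)) (by linarith)
    linarith [Real.log_two_gt_d9]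
  have hA : 4 / (2 * c) + c * 8 ≤ 8 * (c + 1 / c) := by
    have : 4 / (2 * c) = 2 * (1 / c) := by field_simp; norm_num
    have : 0 < 1 / c := by positivity
    linarith
  have hlogT : 0 ≤ Real.log T := Real.log_nonneg (by linarith)
  rw [hcast]
  calc (4 / (2 * c) + c * 8) / √(T : ℝ) * (1 + harmonic (T - 1))
      ≤ (4 / (2 * c) + c * 8) / √(T : ℝ) * (4 * Real.log T) := by gcongr
    _ ≤ (8 * (c + 1 / c)) / √(T : ℝ) * (4 * Real.log T) := by gcongr
    _ = 32 * (c + 1 / c) * (Real.log T / √(T : ℝ)) := by ring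

theorem one_le_log_exp_one_add {x : ℝ} (hx : 0 ≤ x) : 1 ≤ Real.log (Real.exp 1 + x) := by
  rw [Real.le_log_iff_exp_le (by positivity)]
  linarith

/-- With `y = 1 / δ`: `√T ≤ √y ≤ (1 + y) / 2` and `ε ≤ 2 log y ≤ 2 y` bound the argument of the
logarithm by `e + (1 + y) y² ≤ (e + y)³`. -/
theorem log_exp_one_add_sqrt_mul_div_le {T ε y : ℝ} (hy : 2 ≤ y) (hTy : T ≤ y) (hε : 0 < ε)
    (hεy : ε ≤ 2 * Real.log y) :
    Real.log (Real.exp 1 + √T * ε * y) ≤ 3 * Real.log (Real.exp 1 + y) := by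
  have he : 0 < Real.exp 1 := Real.exp_pos 1
  have he1 : 1 ≤ Real.exp 1 := Real.one_le_exp zero_le_one
  have h0 : 0 < y := by linarith
  rw [show (3 : ℝ) = ((3 : ℕ) : ℝ) by norm_num, ← Real.log_pow]
  refine Real.log_le_log (by positivity) ?_
  have h1 : ε ≤ 2 * y := by linarith [Real.log_le_sub_one_of_pos h0]
  have h2 : √T ≤ (1 + y) / 2 := by
    refine (Real.sqrt_le_sqrt hTy).trans ?_
    nlinarith [Real.sq_sqrt h0.le, sq_nonneg (√y - 1)]
  have h3 : √T * ε * y ≤ (1 + y) / 2 * (2 * y) * y := by gcongr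
  have h4 : Real.exp 1 ≤ Real.exp 1 ^ 3 := le_self_pow₀ he1 (by norm_num)
  have h5 : (Real.exp 1 + y) ^ 3
      = Real.exp 1 ^ 3 + 3 * Real.exp 1 ^ 2 * y + 3 * Real.exp 1 * y ^ 2 + y ^ 3 := by ring
  have h6 : y ^ 2 ≤ Real.exp 1 * y ^ 2 := le_mul_of_one_le_left (by positivity) he1
  have h7 : 0 ≤ 3 * Real.exp 1 ^ 2 * y := by positivity
  nlinarith [sq_nonneg y]

/-- The iteration budget is what keeps the total noise variance `n σ²` bounded. -/
theorem natCast_mul_sq_noiseLevel_le {n m T : ℕ} {ε δ : ℝ} (hT : 2 ≤ T) (hε : 0 < ε) (hδ : 0 < δ)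
    (hεδ : ε ≤ max 1 (2 * Real.log (1 / δ))) (hTb : (T : ℝ) ≤ iterationBudget n m ε δ)
    (hTδ : (T : ℝ) ≤ 1 / δ) : n * noiseLevel m T ε δ ^ 2 ≤ 3 := by
  have hT' : (2 : ℝ) ≤ T := by exact_mod_cast hT
  set y := 1 / δ with hy
  have hy2 : 2 ≤ y := hT'.trans hTδ
  have hly : Real.log 2 ≤ Real.log y := Real.log_le_log two_pos hy2
  have hε2 : ε ≤ 2 * Real.log y := by
    rwa [max_eq_right (by linarith [Real.log_two_gt_d9])] at hεδ
  set ℓ := Real.log (Real.exp 1 + y) with hl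
  have hl1 : 1 ≤ ℓ := one_le_log_exp_one_add (by linarith)
  have hA := log_exp_one_add_sqrt_mul_div_le hy2 hTδ hε hε2
  have hA0 : 1 ≤ Real.log (Real.exp 1 + √(T : ℝ) * ε * y) :=
    one_le_log_exp_one_add (by positivity)
  have hB : Real.log (T * y) ≤ 2 * ℓ := by
    rw [Real.log_mul (by positivity) (by positivity)]
    have h1 : Real.log T ≤ Real.log y := Real.log_le_log (by linarith) hTδ
    have h2 : Real.log y ≤ ℓ :=
      Real.log_le_log (by linarith) (by linarith [Real.exp_pos 1])
    linarith
  have hB0 : 0 ≤ Real.log (T * y) := Real.log_nonneg (by nlinarith)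
  have hAB : Real.log (Real.exp 1 + √(T : ℝ) * ε * y) * Real.log (T * y) ≤ 6 * ℓ ^ 2 := by
    calc _ ≤ 3 * ℓ * (2 * ℓ) := by gcongr
      _ = _ := by ring
  have e1 : √(T : ℝ) * ε / δ = √(T : ℝ) * ε * y := by rw [hy]; ring
  have e2 : (T : ℝ) / δ = T * y := by rw [hy]; ring
  rw [sq_noiseLevel (by rw [e1, e2]; positivity), e1, e2]
  -- The budget vanishes by convention for `n = 0`, and for `m = 0`, so both are positive.
  have hbud : 0 < iterationBudget n m ε δ := by linarith
  have hn : (0 : ℝ) < n := by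
    rcases Nat.eq_zero_or_pos n with rfl | h
    · simp [iterationBudget] at hbud
    · exact_mod_cast h
  have hm : (0 : ℝ) < m := by
    rcases Nat.eq_zero_or_pos m with rfl | h
    · simp [iterationBudget] at hbud
    · exact_mod_cast h
  rw [iterationBudget, ← hy, ← hl, le_div_iff₀ (by positivity)] at hTb
  rw [← mul_div_assoc, div_le_iff₀ (by positivity), mul_pow]
  have h2 : (n : ℝ) * (16 * T * (Real.log (Real.exp 1 + √(T : ℝ) * ε * y) * Real.log (T * y)))
      ≤ n * (16 * T * (6 * ℓ ^ 2)) := by gcongr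
  linarith

/-- With the largest admissible number of iterations, `log T ≤ 2 log m` and `1 / √T` is at most
`√2` times the inverse root of the budget. -/
theorem log_div_sqrt_le_of_eq_floor {n m T : ℕ} {ε δ : ℝ} (hT : 2 ≤ T) (hε : 0 < ε) (hδ : 0 < δ)
    (hεδ : ε ≤ max 1 (2 * Real.log (1 / δ))) (hTb : T = ⌊iterationBudget n m ε δ⌋₊) :
    Real.log T / √(T : ℝ)
      ≤ 16 * Real.log (Real.exp 1 + 1 / δ) * (√(n : ℝ) * Real.log m / (m * ε)) := by
  have hT' : (2 : ℝ) ≤ T := by exact_mod_cast hT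
  set ℓ := Real.log (Real.exp 1 + 1 / δ) with hl
  have hl1 : 1 ≤ ℓ := one_le_log_exp_one_add (by positivity)
  have hbud : (T : ℝ) ≤ iterationBudget n m ε δ := by
    refine (Nat.le_floor_iff' (by omega)).1 hTb.le
  have hbud' : iterationBudget n m ε δ < T + 1 := by
    rw [hTb]; exact Nat.lt_floor_add_one _
  have hbud0 : 0 < iterationBudget n m ε δ := by linarith
  have hn : 0 < n := by
    rcases Nat.eq_zero_or_pos n with rfl | h
    · simp [iterationBudget] at hbud0
    · exact h
  have hm : (0 : ℝ) < m := by
    rcases Nat.eq_zero_or_pos m with rfl | h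
    · simp [iterationBudget] at hbud0
    · exact_mod_cast h
  have hn1 : (1 : ℝ) ≤ n := by exact_mod_cast hn
  have hε2 : ε ≤ 2 * ℓ := by
    refine hεδ.trans (max_le (by linarith) ?_)
    have : Real.log (1 / δ) ≤ ℓ :=
      Real.log_le_log (by positivity) (by linarith [Real.exp_pos 1])
    linarith
  have hmε : (m : ℝ) ^ 2 * ε ^ 2 ≤ 2 * T * (32 * n * ℓ ^ 2) := by
    rw [iterationBudget, ← hl, div_lt_iff₀ (by positivity)] at hbud'
    refine hbud'.le.trans ?_
    gcongr
    linarith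
  have hTm : (T : ℝ) ≤ (m : ℝ) ^ 2 := by
    refine hbud.trans ?_
    rw [iterationBudget, ← hl, div_le_iff₀ (by positivity)]
    have : ε ^ 2 ≤ (2 * ℓ) ^ 2 := by gcongr
    have h2 : ε ^ 2 ≤ 32 * n * ℓ ^ 2 := by nlinarith [sq_nonneg ℓ]
    gcongr
  have hlog : Real.log T ≤ 2 * Real.log m := by
    have := Real.log_le_log (by linarith) hTm
    rwa [Real.log_pow] at this
  have hsqrt : m * ε ≤ 8 * √(n : ℝ) * ℓ * √(T : ℝ) := by
    refine (sq_le_sq₀ (by positivity) (by positivity)).1 ?_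
    rw [mul_pow, mul_pow, mul_pow, mul_pow, Real.sq_sqrt (by positivity),
      Real.sq_sqrt (by positivity)]
    linarith
  have hlogT : 0 ≤ Real.log T := Real.log_nonneg (by linarith)
  have hsT : 0 < √(T : ℝ) := by positivity
  rw [← mul_div_assoc, div_le_div_iff₀ hsT (by positivity)]
  calc Real.log T * (m * ε) ≤ 2 * Real.log m * (8 * √(n : ℝ) * ℓ * √(T : ℝ)) := by gcongr
    _ = _ := by ring

end DPExplain

theorem theorem1 :
    -- privacy with respect to the explanation dataset
    (∀ (n m T : ℕ) (f : DPExplain.Vec n → ℝ) (z : DPExplain.Vec n) (α : NNReal → NNReal)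
      (η : ℕ → ℝ) (φ₀ : DPExplain.Vec n) (ε δ : ℝ),
      0 < m → 1 ≤ T → (∀ x, |f x| ≤ 1) → α ∈ DPExplain.weightFamily 1 z →
      φ₀ ∈ DPExplain.feasible n → 0 < ε → 0 < δ → ε ≤ max 1 (2 * Real.log (1 / δ)) →
      DPExplain.IsDifferentiallyPrivate m ε δ
        (fun X => DPExplain.explanationLaw α f z m T ε δ η φ₀ X)) ∧
    -- utility, with a constant `C` that does not depend on anything
    (∃ C : ℝ, 0 < C ∧
      ∀ (n m T : ℕ) (f : DPExplain.Vec n → ℝ) (z : DPExplain.Vec n) (α : NNReal → NNReal)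
        (c : ℝ) (φ₀ : DPExplain.Vec n) (ε δ : ℝ) (X : Multiset (DPExplain.Vec n)),
        Multiset.card X = m → 2 ≤ T → (∀ x, |f x| ≤ 1) → α ∈ DPExplain.weightFamily 1 z →
        φ₀ ∈ DPExplain.feasible n → 0 < ε → 0 < δ → ε ≤ max 1 (2 * Real.log (1 / δ)) →
        0 < c →
        ((T : ℝ) ≤ min (DPExplain.iterationBudget n m ε δ) (1 / δ) →
          DPExplain.ExcessLossLE (DPExplain.localLoss α f z X)
            (DPExplain.explanationLaw α f z m T ε δ (fun t => c / √(t : ℝ)) φ₀ X)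
            (C * (c + 1 / c) * (Real.log T / √(T : ℝ)))) ∧
        (T = ⌊DPExplain.iterationBudget n m ε δ⌋₊ → (T : ℝ) ≤ 1 / δ →
          DPExplain.ExcessLossLE (DPExplain.localLoss α f z X)
            (DPExplain.explanationLaw α f z m T ε δ (fun t => c / √(t : ℝ)) φ₀ X)
            (C * (c + 1 / c) * Real.log (Real.exp 1 + 1 / δ) *
              (√(n : ℝ) * Real.log m / (m * ε))))) := by
  refine ⟨fun n m T f z α η φ₀ ε δ hm hT hf hα hφ₀ hε hδ hεδ =>
    DPExplain.isDifferentiallyPrivate_explanationLaw η hm hT hf hα hφ₀ hε hδ hεδ,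
    512, by norm_num, fun n m T f z α c φ₀ ε δ X _ hT hf hα hφ₀ hε hδ hεδ hc => ?_⟩
  have hmain : (T : ℝ) ≤ DPExplain.iterationBudget n m ε δ → (T : ℝ) ≤ 1 / δ →
      DPExplain.ExcessLossLE (DPExplain.localLoss α f z X)
        (DPExplain.explanationLaw α f z m T ε δ (fun t => c / √(t : ℝ)) φ₀ X)
        (32 * (c + 1 / c) * (Real.log T / √(T : ℝ))) := fun hTb hTδ =>
    DPExplain.excessLossLE_explanationLaw X hT hf hα hφ₀ hc
      (DPExplain.natCast_mul_sq_noiseLevel_le hT hε hδ hεδ hTb hTδ)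
  have hcc : 0 < c + 1 / c := by positivity
  refine ⟨fun hTmin => ?_, fun hTb hTδ => ?_⟩
  · obtain ⟨h1, h2⟩ := hmain (hTmin.trans (min_le_left _ _)) (hTmin.trans (min_le_right _ _))
    refine ⟨h1, fun φs hφs => (h2 φs hφs).trans ?_⟩
    have : 0 ≤ Real.log T / √(T : ℝ) := by positivity
    gcongr
    norm_num
  · obtain ⟨h1, h2⟩ := hmain ((Nat.le_floor_iff' (by omega)).1 hTb.le) hTδ
    refine ⟨h1, fun φs hφs => (h2 φs hφs).trans ?_⟩
    refine (mul_le_mul_of_nonneg_left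
      (DPExplain.log_div_sqrt_le_of_eq_floor hT hε hδ hεδ hTb) (by positivity)).trans
      (le_of_eq ?_)
    ring
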